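/- For $g>0$ let $Z(g)=\int_{-\infty}^{\infty}e^{-x^2/2-gx^4}\,dx$. For a sequence of real numbers $M(N)$ (the order of the self-consistently conserved moment $\langle x^{2M(N)}\rangle$ at order $N$) put $G=G(N,g)=\frac12+\frac12\sqrt{1+16g(M(N)+2)}$ and let $$Z^{(N)}(g)=\int_{-\infty}^{\infty}e^{-\frac12Gx^2}\sum_{n=0}^{N}\frac{1}{n!}\Bigl(-\bigl[\tfrac12(1-G)x^2+gx^4\bigr]\Bigr)^n\,dx$$ be the $N$-th order self-consistent expansion (SCE). Write $M(N)\sim N^p$ if there are $c,C>0$ with $cN^p\le M(N)\le CN^p$ for all large $N$. For $\alpha>0$ put $$Q_2(\alpha)=2\Bigl(\frac2\alpha+1\Bigr)e^{-1-\frac\alpha2-\frac{\alpha^2}{\alpha+2}},\qquad Q_1(\alpha)=\frac{\alpha}{\alpha+1},$$ $$A(\alpha)=-\log_{10}\max\{Q_1(\alpha),Q_2(\alpha)\},\qquad B(\alpha,g)=\frac{1}{4\ln 10\,\sqrt{g\alpha}}.$$ (1) If $M(N)\sim N^p$ with $0\le p<1$, then for every $g>0$ the SCE diverges, with $(-1)^NZ^{(N)}(g)\to+\infty$.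 (2) The equation $Q_2(\alpha)=1$ has exactly one positive solution $\alpha_c$, and $Q_2(\alpha)=Q_1(\alpha)$ exactly one positive solution $\alpha^*$; $|\alpha_c-0.976|\le 0.0005$ and $|\alpha^*-1.317|\le 0.0005$. Moreover: (2a) Let $M(N)\sim N^p$ with $1\le p<2$; if $p=1$, suppose in addition that there is $a>\alpha_c$ with $M(N)\ge aN$ for all large $N$. Then $Z^{(N)}\to Z$ uniformly on $g>0$, and there are a constant $A>0$, independent of $N$ and $g$, and a function $B(g)>0$, independent of $N$, such that for all sufficiently large $N$ and all $g>0$ $$|Z^{(N)}(g)-Z(g)|\le\exp\{-AN^{2-p}-B(g)N^{1-p/2}\}.$$ (2b) Let $M(N)=\alpha N$ with $\alpha>\alpha_c$. Then $A(\alpha)>0$; there is $C$ with $|Z^{(N)}(g)-Z(g)|\le C\,10^{-A(\alpha)N}$ for all $N$ and all $g>0$; and for every fixed $g>0$, $|Z^{(N)}(g)-Z(g)|=O\bigl(10^{-A(\alpha)N-B(\alpha,g)\sqrt N}\bigr)$ as $N\to\infty$. Here $A(\alpha)=-\log_{10}Q_2(\alpha)$ for $0<\alpha\le\alpha^*$ and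 $A(\alpha)=-\log_{10}Q_1(\alpha)$ for $\alpha\ge\alpha^*$; the rate $A$ on $(0,\infty)$ attains its maximum exactly at $\alpha^*$, and $0.245\le A(\alpha^*)\le0.2455$. Conversely, for $p=1$ convergence holds only if $M(N)/N$ is sufficiently large: there is $\alpha_0>0$ such that if $M(N)\sim N$ and $M(N)\le\alpha_0N$ for all large $N$, then for no $g>0$ does $Z^{(N)}(g)$ converge. (3) If $M(N)\sim N^p$ with $p>2$, then $Z^{(N)}(g)\to0$ for every $g>0$. -/

import Mathlib

open Filter Topology

namespace SCE

/-- The partition function `Z(g) = ∫ exp(-(x²/2 + g x⁴)) dx` of the quartic oscillator. -/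
noncomputable def Z (g : ℝ) : ℝ :=
  ∫ x : ℝ, Real.exp (-(x ^ 2 / 2 + g * x ^ 4))

/-- The self-consistent harmonic coefficient `G = 1/2 + 1/2 √(1 + 16 g (M + 2))` attached to the
conserved moment `⟨x^(2M)⟩`. -/
noncomputable def G (g M : ℝ) : ℝ :=
  1 / 2 + 1 / 2 * √(1 + 16 * g * (M + 2))

/-- The self-consistent expansion `Z^(N)(g)` of order `N`: split the potential as
`(G/2) x² + ((1 - G)/2 x² + g x⁴)`, with `G = G(g, M(N))`, expand the exponential of the second
part up to order `N`, and integrate. -/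
noncomputable def approx (M : ℕ → ℝ) (N : ℕ) (g : ℝ) : ℝ :=
  ∫ x : ℝ, Real.exp (-(G g (M N) / 2 * x ^ 2)) *
    ∑ n ∈ Finset.range (N + 1),
      (-((1 - G g (M N)) / 2 * x ^ 2 + g * x ^ 4)) ^ n / (n.factorial : ℝ)

/-- `M(N)` scales as `N ^ p`: it lies between two positive multiples of `N ^ p` for large `N`. -/
def ScalesAs (M : ℕ → ℝ) (p : ℝ) : Prop :=
  ∃ c C : ℝ, 0 < c ∧ ∀ᶠ N : ℕ in atTop, c * (N : ℝ) ^ p ≤ M N ∧ M N ≤ C * (N : ℝ) ^ p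

/-- The exponential base `2 (2/α + 1) exp(-1 - α/2 - α²/(α + 2))`. -/
noncomputable def tailBase (α : ℝ) : ℝ :=
  2 * (2 / α + 1) * Real.exp (-1 - α / 2 - α ^ 2 / (α + 2))

/-- The exponential base `α/(α + 1)`. -/
noncomputable def headBase (α : ℝ) : ℝ :=
  α / (α + 1)

/-- The decimal exponential rate `A(α)`, given by the larger of the two bases. -/
noncomputable def rateA (α : ℝ) : ℝ :=
  -Real.logb 10 (max (tailBase α) (headBase α))

/-- The coefficient of the stretched exponential: `10 ^ (-B √N) = exp(-(1/4) √(N/(g α)))`. -/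
noncomputable def rateB (α g : ℝ) : ℝ :=
  1 / (4 * Real.log 10 * √(g * α))

end SCE

namespace SCE

/-! Put m = M(N) + 2, t = G x²/2 and θ = 1 - 1/G. Since G(G - 1) = 4gm, the negated perturbation is
θw with w = t(1 - t/m), and the error is the integral of e^{-t} times the Taylor remainder of exp at
θw. A factor θ^{N+1} ≤ exp(-(N+1)/G) splits off, and what is left is bounded independently of g
because G ≥ 1.

Let n = N + 1. For t ≤ m the omitted terms are nonnegative and e^{-t} w^k/k! is at most about
(m/(m+k))^k, which gives the base Q₁ when m ≈ αN (`head_remainder_le`). For t ≥ m the series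
alternates, so the remainder is at most the first omitted term; tangents to the logarithm bound it
by a geometric factor times a leftover Gaussian (`tail_remainder_le`). With a suitable tangent point
that factor stays below max{Q₁, Q₂} for α ≥ 0.9755, slightly below α_c
(`exists_tangentBase_lt_max`). The two regions are added in `abs_approx_sub_Z_le`. For M ~ N^p with
1 ≤ p < 2 the head decays like exp(-cN^{2-p}) and the tail at least exponentially in N.

If m is small against N, the term of order N is huge where t is between N and 2N and dominates with
sign (-1)^N (`exp_le_neg_one_pow_mul_approx`). If p > 2, then G outgrows N: the range t ≤ 4N is an
x-interval of length of order √(N/G), which shrinks to zero, and the rest is small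
(`abs_approx_le`). -/

open Real Finset MeasureTheory

/-! ### Taylor remainders and partial sums of the exponential -/

/-- The Taylor remainder of `exp` at a nonpositive point alternates in sign and is bounded by the
first omitted term. -/
theorem exp_neg_remainder_bounds (n : ℕ) {v : ℝ} (hv : 0 ≤ v) :
    0 ≤ (-1 : ℝ) ^ n * (exp (-v) - ∑ k ∈ range n, (-v) ^ k / (k.factorial : ℝ)) ∧
    (-1 : ℝ) ^ n * (exp (-v) - ∑ k ∈ range n, (-v) ^ k / (k.factorial : ℝ)) ≤
      v ^ n / (n.factorial : ℝ) := by
  induction n generalizing v with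
  | zero => simpa using ⟨(exp_pos _).le, hv⟩
  | succ n ih =>
    set R : ℕ → ℝ → ℝ := fun n v =>
      (-1 : ℝ) ^ n * (exp (-v) - ∑ k ∈ range n, (-v) ^ k / (k.factorial : ℝ)) with hR
    have hsum : ∀ v : ℝ, HasDerivAt
        (fun v : ℝ => ∑ k ∈ range (n + 1), (-v) ^ k / (k.factorial : ℝ))
        (-∑ k ∈ range n, (-v) ^ k / (k.factorial : ℝ)) v := by
      intro v
      have h1 : ∀ k ∈ range (n + 1), HasDerivAt (fun v : ℝ => (-v) ^ k / (k.factorial : ℝ))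
          ((k * (-v) ^ (k - 1) * (-1)) / (k.factorial : ℝ)) v := by
        intro k _
        exact (((hasDerivAt_id v).neg).pow k).div_const _
      have h2 := HasDerivAt.fun_sum h1
      refine h2.congr_deriv ?_
      rw [Finset.sum_range_succ', ← Finset.sum_neg_distrib]
      simp only [Nat.cast_zero, zero_mul, zero_div, add_zero]
      refine Finset.sum_congr rfl fun k _ => ?_
      rw [Nat.factorial_succ]
      push_cast
      have : (k.factorial : ℝ) ≠ 0 := by positivity
      have : (k : ℝ) + 1 ≠ 0 := by positivity
      field_simp
    -- The signed remainders form a chain of antiderivatives vanishing at 0, as do the terms v^n/n!,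
    -- so both inequalities pass from n to n + 1 by monotonicity.
    have hder : ∀ v : ℝ, HasDerivAt (R (n + 1)) (R n v) v := by
      intro v
      have h1 : HasDerivAt (fun v : ℝ => exp (-v)) (exp (-v) * (-1)) v :=
        ((hasDerivAt_id v).neg).exp
      refine ((h1.sub (hsum v)).const_mul ((-1 : ℝ) ^ (n + 1))).congr_deriv ?_
      simp only [hR, pow_succ]
      ring
    have hpow : ∀ v : ℝ, HasDerivAt (fun v : ℝ => v ^ (n + 1) / ((n + 1).factorial : ℝ))
        (v ^ n / (n.factorial : ℝ)) v := by
      intro v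
      refine ((hasDerivAt_pow (n + 1) v).div_const ((n + 1).factorial : ℝ)).congr_deriv ?_
      rw [Nat.factorial_succ]
      push_cast
      have : (n : ℝ) + 1 ≠ 0 := by positivity
      field_simp
    have hz : R (n + 1) 0 = 0 := by
      simp [hR, Finset.sum_range_succ']
    have hmono1 : MonotoneOn (R (n + 1)) (Set.Ici 0) := by
      refine monotoneOn_of_deriv_nonneg (convex_Ici 0)
        (fun x _ => (hder x).continuousAt.continuousWithinAt)
        (fun x _ => (hder x).differentiableAt.differentiableWithinAt) fun x hx => ?_
      rw [interior_Ici] at hx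
      rw [(hder x).deriv]
      exact (ih (le_of_lt hx)).1
    have hmono2 : MonotoneOn (fun v => v ^ (n + 1) / ((n + 1).factorial : ℝ) - R (n + 1) v)
        (Set.Ici 0) := by
      refine monotoneOn_of_deriv_nonneg (convex_Ici 0)
        (fun x _ => ((hpow x).sub (hder x)).continuousAt.continuousWithinAt)
        (fun x _ => ((hpow x).sub (hder x)).differentiableAt.differentiableWithinAt)
        fun x hx => ?_
      rw [interior_Ici] at hx
      rw [((hpow x).fun_sub (hder x)).deriv]
      exact sub_nonneg.2 (ih (le_of_lt hx)).2
    have a1 := hmono1 (Set.self_mem_Ici) (Set.mem_Ici.2 hv) hv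
    have a2 := hmono2 (Set.self_mem_Ici) (Set.mem_Ici.2 hv) hv
    simp only [hz] at a1 a2
    refine ⟨a1, ?_⟩
    have : (0 : ℝ) ^ (n + 1) / ((n + 1).factorial : ℝ) = 0 := by simp
    rw [this] at a2
    show R (n + 1) v ≤ _
    linarith

theorem abs_exp_neg_sub_partial_le (n : ℕ) {v : ℝ} (hv : 0 ≤ v) :
    |exp (-v) - ∑ k ∈ range n, (-v) ^ k / (k.factorial : ℝ)| ≤ v ^ n / (n.factorial : ℝ) := by
  have h := exp_neg_remainder_bounds n hv
  have h2 : |exp (-v) - ∑ k ∈ range n, (-v) ^ k / (k.factorial : ℝ)| =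
      |(-1 : ℝ) ^ n * (exp (-v) - ∑ k ∈ range n, (-v) ^ k / (k.factorial : ℝ))| := by
    rw [abs_mul, abs_pow]; simp
  rw [h2, abs_of_nonneg h.1]
  exact h.2

theorem partial_exp_le_exp (n : ℕ) {w : ℝ} (hw : 0 ≤ w) :
    ∑ k ∈ range n, w ^ k / (k.factorial : ℝ) ≤ exp w :=
  Real.sum_le_exp_of_nonneg hw n

/-- The partial sum of order `N`, with the sign `(-1) ^ N`, is at least `-exp w`. -/
theorem neg_exp_le_partial (N : ℕ) (w : ℝ) :
    -exp w ≤ (-1 : ℝ) ^ N * ∑ k ∈ range (N + 1), w ^ k / (k.factorial : ℝ) := by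
  rcases le_total 0 w with hw | hw
  · have h1 := partial_exp_le_exp (N + 1) hw
    have h2 : 0 ≤ ∑ k ∈ range (N + 1), w ^ k / (k.factorial : ℝ) :=
      Finset.sum_nonneg fun k _ => by positivity
    rcases neg_one_pow_eq_or ℝ N with h | h <;> rw [h] <;> linarith
  · have h := (exp_neg_remainder_bounds (N + 1) (neg_nonneg.2 hw)).1
    rw [neg_neg, pow_succ] at h
    have h3 := exp_pos w
    rcases neg_one_pow_eq_or ℝ N with h' | h' <;> rw [h'] at h ⊢ <;> linarith

/-- For `v ≥ 2 N` the last term of the partial sum dominates. -/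
theorem half_last_term_le_partial (N : ℕ) {v : ℝ} (hv : 2 * (N : ℝ) ≤ v) :
    v ^ N / (2 * (N.factorial : ℝ)) ≤
      exp (-v) + (-1 : ℝ) ^ N * ∑ k ∈ range (N + 1), (-v) ^ k / (k.factorial : ℝ) := by
  have hv0 : 0 ≤ v := le_trans (by positivity) hv
  rcases N with _ | N
  · have := exp_pos (-v)
    simp
    norm_num
    linarith
  -- The order is now N + 1. The last term is at least twice the preceding one, so half of it
  -- absorbs that term and the other half remains.
  have hvN : (N + 1 : ℝ) * (v ^ N) * 2 ≤ v ^ (N + 1) := by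
    rw [pow_succ]
    push_cast at hv
    nlinarith [pow_nonneg hv0 N]
  have hf : ((N + 1).factorial : ℝ) = (N + 1) * (N.factorial : ℝ) := by
    rw [Nat.factorial_succ]; push_cast; ring
  have hpos : (0 : ℝ) < (N.factorial : ℝ) := by positivity
  have key : v ^ N / (N.factorial : ℝ) ≤ v ^ (N + 1) / (2 * ((N + 1).factorial : ℝ)) := by
    rw [hf, div_le_div_iff₀ hpos (by positivity)]
    nlinarith
  have hdouble : v ^ (N + 1) / ((N + 1).factorial : ℝ) =
      v ^ (N + 1) / (2 * ((N + 1).factorial : ℝ)) * 2 := by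
    rw [hf]; field_simp
  have hlast : (-1 : ℝ) ^ (N + 1) * ((-v) ^ (N + 1) / ((N + 1).factorial : ℝ)) =
      v ^ (N + 1) / ((N + 1).factorial : ℝ) := by
    rw [← mul_div_assoc, ← mul_pow]; simp
  have hprev : (-1 : ℝ) ^ (N + 1) * ((-v) ^ N / (N.factorial : ℝ)) =
      -(v ^ N / (N.factorial : ℝ)) := by
    rw [pow_succ, mul_right_comm, ← mul_div_assoc, ← mul_pow]; simp
  have h0 := (exp_neg_remainder_bounds N hv0).1
  -- The sign of the remainder after N terms limits the loss from the shorter sum to exp (-v).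
  have hrest : -exp (-v) ≤
      (-1 : ℝ) ^ (N + 1) * ∑ k ∈ range N, (-v) ^ k / (k.factorial : ℝ) := by
    have hexp := exp_pos (-v)
    rw [pow_succ]
    rcases neg_one_pow_eq_or ℝ N with h' | h' <;> rw [h'] at h0 ⊢ <;> linarith
  rw [Finset.sum_range_succ, Finset.sum_range_succ, mul_add, mul_add, hlast, hprev]
  linarith

/-! ### The head region t ≤ m -/

theorem stirling_lower {k : ℕ} :
    √(2 * π * k) * ((k : ℝ) ^ k * exp (-k)) ≤ (k.factorial : ℝ) := by
  refine le_trans (le_of_eq ?_) (Stirling.le_factorial_stirling k)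
  rw [div_pow, ← exp_nat_mul, mul_one, exp_neg, div_eq_mul_inv]

/-- AM-GM bounds (1 - t/m)(t/k + t/m) by ((1 + t/k)/2)², and 1 + u ≤ e^u turns this into exp(t/k -
1), whose k-th power cancels the weight e^{-t}. -/
theorem head_factor_le {t m k : ℝ} (hm : 0 < m) (hk : 0 < k) :
    t * (1 - t / m) ≤ k * (m / (m + k)) * exp (t / k - 1) := by
  have h1 : (1 + (t / k - 1) / 2) ^ 2 ≤ exp (t / k - 1) ∨ 1 + (t / k - 1) / 2 < 0 := by
    rcases le_or_gt 0 (1 + (t / k - 1) / 2) with h | h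
    · left
      have h2 : 1 + (t / k - 1) / 2 ≤ exp ((t / k - 1) / 2) := by
        linarith [add_one_le_exp ((t / k - 1) / 2)]
      calc _ ≤ exp ((t / k - 1) / 2) ^ 2 := pow_le_pow_left₀ h h2 2
        _ = _ := by rw [← exp_nat_mul]; congr 1; push_cast; ring
    · exact Or.inr h
  rcases h1 with h1 | h1
  · calc t * (1 - t / m) = k * (m / (m + k)) * ((1 - t / m) * (t / k + t / m)) := by
          field_simp
      _ ≤ k * (m / (m + k)) * (1 + (t / k - 1) / 2) ^ 2 := by
          gcongr
          nlinarith [sq_nonneg (1 - t / m - (t / k + t / m))]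
      _ ≤ _ := by gcongr
  · have ht : t < 0 := by
      by_contra h
      have : 0 ≤ t / k := div_nonneg (not_lt.1 h) hk.le
      linarith
    have : t / m < 0 := div_neg_of_neg_of_pos ht hm
    have h3 : t * (1 - t / m) ≤ 0 := mul_nonpos_of_nonpos_of_nonneg ht.le (by linarith)
    exact h3.trans (by positivity)

theorem head_term_le {t m : ℝ} {k : ℕ} (hm : 0 < m) (hk : k ≠ 0) (ht : 0 ≤ t) (htm : t ≤ m) :
    (t * (1 - t / m)) ^ k / (k.factorial : ℝ) * exp (-t) ≤
      (m / (m + k)) ^ k / √(2 * π * k) := by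
  have hk' : (0 : ℝ) < k := by positivity
  have h0 : 0 ≤ t * (1 - t / m) := mul_nonneg ht (sub_nonneg.2 ((div_le_one hm).2 htm))
  have h1 := pow_le_pow_left₀ h0 (head_factor_le (t := t) hm hk') k
  have h2 : (k * (m / (m + k)) * exp (t / k - 1)) ^ k * exp (-t) =
      (m / (m + k)) ^ k * ((k : ℝ) ^ k * exp (-k)) := by
    rw [mul_pow, mul_pow, ← exp_nat_mul, mul_assoc, ← exp_add]
    have : (k : ℝ) * (t / k - 1) + -t = -k := by field_simp; ring_nf
    rw [this]; ring
  have hs : 0 < √(2 * π * k) := by positivity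
  rw [div_mul_eq_mul_div, div_le_div_iff₀ (by positivity) hs]
  calc (t * (1 - t / m)) ^ k * exp (-t) * √(2 * π * k)
      ≤ (k * (m / (m + k)) * exp (t / k - 1)) ^ k * exp (-t) * √(2 * π * k) := by gcongr
    _ = (m / (m + k)) ^ k * (√(2 * π * k) * ((k : ℝ) ^ k * exp (-k))) := by rw [h2]; ring
    _ ≤ _ := by
      gcongr
      exact stirling_lower

/-- The omitted terms are nonnegative, and `head_term_le` dominates them by a geometric series of
ratio m/(m+n), since m/(m+k) decreases in k. Its sum supplies the factor (m+n)/n. -/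
theorem head_remainder_le {t m θ : ℝ} {n : ℕ} (hm : 0 < m) (hn : n ≠ 0) (ht : 0 ≤ t)
    (htm : t ≤ m) (hθ : 0 ≤ θ) (hθ1 : θ ≤ 1) :
    exp (-t) * |exp (θ * (t * (1 - t / m))) -
        ∑ k ∈ range n, (θ * (t * (1 - t / m))) ^ k / (k.factorial : ℝ)| ≤
      θ ^ n * ((m / (m + n)) ^ n * ((m + n) / n) / √(2 * π * n)) := by
  have hn' : (0 : ℝ) < n := by positivity
  set w := t * (1 - t / m) with hw
  have h0 : 0 ≤ w := mul_nonneg ht (sub_nonneg.2 ((div_le_one hm).2 htm))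
  have hexp : HasSum (fun k : ℕ => (θ * w) ^ k / (k.factorial : ℝ)) (exp (θ * w)) := by
    rw [Real.exp_eq_exp_ℝ]
    exact NormedSpace.expSeries_div_hasSum_exp (θ * w)
  have hrem := (hasSum_nat_add_iff' n).2 hexp
  rw [abs_of_nonneg (sub_nonneg.2 (partial_exp_le_exp n (mul_nonneg hθ h0)))]
  set q := m / (m + n) with hq
  have hq0 : 0 < q := by positivity
  have hq1 : q < 1 := (div_lt_one (by positivity)).2 (by linarith)
  have hgeo : HasSum (fun k : ℕ => θ ^ n * (q ^ n / √(2 * π * n)) * q ^ k)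
      (θ ^ n * (q ^ n / √(2 * π * n)) * (1 - q)⁻¹) :=
    (hasSum_geometric_of_lt_one hq0.le hq1).mul_left _
  have hle : ∀ k : ℕ, exp (-t) * ((θ * w) ^ (k + n) / ((k + n).factorial : ℝ)) ≤
      θ ^ n * (q ^ n / √(2 * π * n)) * q ^ k := by
    intro k
    have h1 := head_term_le (k := k + n) hm (by omega) ht htm
    have h2 : m / (m + (k + n : ℕ)) ≤ q := by
      rw [hq]
      gcongr
      linarith
    have h3 : √(2 * π * n) ≤ √(2 * π * (k + n : ℕ)) := by
      apply Real.sqrt_le_sqrt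
      gcongr
      linarith
    have hs : 0 < √(2 * π * n) := by positivity
    calc exp (-t) * ((θ * w) ^ (k + n) / ((k + n).factorial : ℝ))
        = θ ^ (k + n) * (w ^ (k + n) / ((k + n).factorial : ℝ) * exp (-t)) := by
          rw [mul_pow]; ring
      _ ≤ θ ^ n * ((m / (m + (k + n : ℕ))) ^ (k + n) / √(2 * π * (k + n : ℕ))) := by
          apply mul_le_mul _ h1 (by positivity) (by positivity)
          exact pow_le_pow_of_le_one hθ hθ1 (by omega)
      _ ≤ θ ^ n * (q ^ (k + n) / √(2 * π * n)) := by gcongr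
      _ = _ := by rw [pow_add]; ring
  have := hasSum_le hle (hrem.mul_left (exp (-t))) hgeo
  refine this.trans (le_of_eq ?_)
  have : (1 - q)⁻¹ = (m + n) / n := by
    rw [hq, one_sub_div (by positivity), inv_div, add_sub_cancel_left]
  rw [this]; ring

/-! ### The tail region t ≥ m -/

/-- The base of the geometric bound for the tail `t ≥ m`, obtained by majorizing
`log (s (s - 1))` by its tangent at `s = 1 + c / a`. -/
noncomputable def tangentBase (c a : ℝ) : ℝ :=
  c * (1 + c / a) * exp (-1 - a / c)

/-- The fraction of the Gaussian weight that the tangent bound leaves over. -/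
noncomputable def tangentGap (c a : ℝ) : ℝ :=
  1 - 1 / c - 1 / (a + c)

theorem tangentBase_pos {c a : ℝ} (hc : 0 < c) (ha : 0 < a) : 0 < tangentBase c a := by
  unfold tangentBase; positivity

theorem tangentBase_antitone {c a b : ℝ} (hc : 0 < c) (ha : 0 < a) (hab : a ≤ b) :
    tangentBase c b ≤ tangentBase c a := by
  unfold tangentBase
  have hb : 0 < b := ha.trans_le hab
  gcongr

theorem tangentGap_monotone {c a b : ℝ} (hc : 0 < c) (ha : 0 < a) (hab : a ≤ b) :
    tangentGap c a ≤ tangentGap c b := by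
  unfold tangentGap
  gcongr

/-- The tangent bounds for log s and log (s - 1), both taken at s = 1 + c/a, added and
exponentiated. -/
theorem tail_factor_le {c a s : ℝ} (hc : 0 < c) (ha : 0 < a) (hs : 1 ≤ s) :
    a * (s * (s - 1)) ≤ c * (1 + c / a) * exp (s * a * (1 / c + 1 / (a + c)) - 2 - a / c) := by
  set r := c / a with hr
  have hr0 : 0 < r := by positivity
  have h1 : s - 1 ≤ r * exp ((s - 1) / r - 1) := by
    have := add_one_le_exp ((s - 1) / r - 1)
    rw [sub_add_cancel, div_le_iff₀ hr0] at this
    linarith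
  have h2 : s ≤ (1 + r) * exp (s / (1 + r) - 1) := by
    have := add_one_le_exp (s / (1 + r) - 1)
    rw [sub_add_cancel, div_le_iff₀ (by positivity)] at this
    linarith
  have h3 : exp (s / (1 + r) - 1) * exp ((s - 1) / r - 1) =
      exp (s * a * (1 / c + 1 / (a + c)) - 2 - a / c) := by
    rw [← exp_add]
    congr 1
    rw [hr]
    field_simp
    ring
  calc a * (s * (s - 1)) ≤ a * (((1 + r) * exp (s / (1 + r) - 1)) * (r * exp ((s - 1) / r - 1))) := by
        gcongr
    _ = (a * r) * (1 + r) * (exp (s / (1 + r) - 1) * exp ((s - 1) / r - 1)) := by ring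
    _ = _ := by
      rw [h3, hr, mul_div_cancel₀ _ ha.ne']

/-- The n-th power of `tail_factor_le` at b = m/n, combined with n^n ≤ n! e^n. The part of the
tangent linear in t uses up all of e^{-t} except the fraction `tangentGap`; passing from b to a is
monotonicity. -/
theorem tail_term_le {c a t m : ℝ} {n : ℕ} (hn : n ≠ 0) (hc : 0 < c) (ha : 0 < a)
    (ham : a * n ≤ m) (hmt : m ≤ t) :
    exp (-t) * ((t * (t / m - 1)) ^ n / (n.factorial : ℝ)) ≤
      tangentBase c a ^ n * exp (-(tangentGap c a * t)) := by
  have hn' : (0 : ℝ) < n := by positivity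
  have hm : 0 < m := lt_of_lt_of_le (by positivity) ham
  have ht : 0 < t := hm.trans_le hmt
  set b := m / n with hb
  have hab : a ≤ b := (le_div_iff₀ hn').2 ham
  have hb0 : 0 < b := ha.trans_le hab
  have hbn : m = b * n := by rw [hb]; field_simp
  have hs1 : 1 ≤ t / m := (one_le_div hm).2 hmt
  have h1 := tail_factor_le hc hb0 hs1
  have h2 : t * (t / m - 1) = n * (b * (t / m * (t / m - 1))) := by
    rw [hbn]; field_simp
  have hnn : 0 ≤ b * (t / m * (t / m - 1)) :=
    mul_nonneg hb0.le (mul_nonneg (by positivity) (by linarith))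
  have h3 := pow_le_pow_left₀ hnn h1 n
  have hfac : (n : ℝ) ^ n ≤ (n.factorial : ℝ) * exp n := by
    have := stirling_lower (k := n)
    have h1s : 1 ≤ √(2 * π * n) := by
      rw [Real.one_le_sqrt]
      have h1n : (1 : ℝ) ≤ n := by exact_mod_cast Nat.one_le_iff_ne_zero.2 hn
      nlinarith [pi_gt_three]
    have h4 : (n : ℝ) ^ n * exp (-n) ≤ (n.factorial : ℝ) := by
      refine le_trans ?_ this
      exact le_mul_of_one_le_left (by positivity) h1s
    rw [exp_neg, ← div_eq_mul_inv, div_le_iff₀ (exp_pos _)] at h4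
    exact h4
  have h5 : exp (-t) * (exp n * (c * (1 + c / b) *
      exp (t / m * b * (1 / c + 1 / (b + c)) - 2 - b / c)) ^ n) =
      tangentBase c b ^ n * exp (-(tangentGap c b * t)) := by
    unfold tangentBase tangentGap
    rw [mul_pow, mul_pow (c * (1 + c / b)), ← exp_nat_mul, ← exp_nat_mul]
    rw [mul_left_comm (exp n), mul_left_comm (exp (-t)), mul_assoc ((c * (1 + c / b)) ^ n),
      ← exp_add, ← exp_add, ← exp_add]
    congr 2
    rw [hbn]
    field_simp
    ring
  have hgap := tangentGap_monotone hc ha hab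
  have hbase := tangentBase_antitone hc ha hab
  calc exp (-t) * ((t * (t / m - 1)) ^ n / (n.factorial : ℝ))
      = exp (-t) * ((n : ℝ) ^ n / (n.factorial : ℝ) * (b * (t / m * (t / m - 1))) ^ n) := by
        rw [h2, mul_pow]; ring
    _ ≤ exp (-t) * (exp n * (c * (1 + c / b) *
          exp (t / m * b * (1 / c + 1 / (b + c)) - 2 - b / c)) ^ n) := by
        gcongr
        rw [div_le_iff₀ (by positivity)]
        linarith
    _ = tangentBase c b ^ n * exp (-(tangentGap c b * t)) := h5
    _ ≤ _ := by
        have := (tangentBase_pos hc hb0).le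
        have := (tangentBase_pos hc ha).le
        gcongr

/-! ### The self-consistent coefficient and the scaled variable -/

theorem one_le_G {g M : ℝ} (hg : 0 ≤ g) (hM : 0 ≤ M + 2) : 1 ≤ G g M := by
  unfold G
  have : 1 ≤ √(1 + 16 * g * (M + 2)) := by
    rw [Real.one_le_sqrt]
    have : 0 ≤ g * (M + 2) := by positivity
    linarith
  linarith

/-- The self-consistency equation. It makes the quadratic and quartic parts of the perturbation
cancel exactly at t = m. -/
theorem G_mul_sub_one {g M : ℝ} (hg : 0 ≤ g) (hM : 0 ≤ M + 2) :
    G g M * (G g M - 1) = 4 * g * (M + 2) := by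
  unfold G
  have : 0 ≤ g * (M + 2) := by positivity
  have h := Real.sq_sqrt (show 0 ≤ 1 + 16 * g * (M + 2) by linarith)
  linear_combination h / 4

theorem G_le {g M : ℝ} (hg : 0 ≤ g) (hM : 0 ≤ M + 2) : G g M ≤ 1 + 2 * √(g * (M + 2)) := by
  unfold G
  have h0 : 0 ≤ g * (M + 2) := by positivity
  have h : √(1 + 16 * g * (M + 2)) ≤ 1 + 4 * √(g * (M + 2)) := by
    apply Real.sqrt_le_iff.2
    refine ⟨by positivity, ?_⟩
    nlinarith [Real.sq_sqrt h0, Real.sqrt_nonneg (g * (M + 2))]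
  linarith

theorem le_G {g M : ℝ} (hg : 0 ≤ g) (hM : 0 ≤ M + 2) : 2 * √(g * (M + 2)) ≤ G g M := by
  unfold G
  have h0 : 0 ≤ g * (M + 2) := by positivity
  have h : 4 * √(g * (M + 2)) ≤ √(1 + 16 * g * (M + 2)) := by
    apply Real.le_sqrt_of_sq_le
    nlinarith [Real.sq_sqrt h0, Real.sqrt_nonneg (g * (M + 2))]
  linarith

/-- The fraction `θ = (G - 1)/G` of the Gaussian weight that is expanded. -/
noncomputable def frac (g M : ℝ) : ℝ := 1 - 1 / G g M

theorem frac_nonneg {g M : ℝ} (hg : 0 ≤ g) (hM : 0 ≤ M + 2) : 0 ≤ frac g M := by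
  have h := one_le_G hg hM
  unfold frac
  rw [sub_nonneg, div_le_one (by linarith)]
  exact h

theorem frac_le_one {g M : ℝ} (hg : 0 ≤ g) (hM : 0 ≤ M + 2) : frac g M ≤ 1 := by
  have h := one_le_G hg hM
  unfold frac
  have : 0 ≤ 1 / G g M := by positivity
  linarith

/-- The negated perturbation in the scaled variable `t = G x² / 2`. -/
theorem perturbation_eq {g M : ℝ} (hg : 0 ≤ g) (hM : 0 < M + 2) (x : ℝ) :
    -((1 - G g M) / 2 * x ^ 2 + g * x ^ 4) =
      frac g M * (G g M / 2 * x ^ 2 * (1 - G g M / 2 * x ^ 2 / (M + 2))) := by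
  have h1 := one_le_G hg hM.le
  have h2 := G_mul_sub_one hg hM.le
  unfold frac
  have h3 : G g M ≠ 0 := by positivity
  have h4 : g = G g M * (G g M - 1) / (4 * (M + 2)) := by
    rw [h2]; field_simp
  generalize G g M = γ at *
  rw [h4]
  field_simp
  ring

theorem weight_eq {g M : ℝ} (hg : 0 ≤ g) (hM : 0 < M + 2) (x : ℝ) :
    exp (-(x ^ 2 / 2 + g * x ^ 4)) = exp (-(G g M / 2 * x ^ 2)) *
      exp (frac g M * (G g M / 2 * x ^ 2 * (1 - G g M / 2 * x ^ 2 / (M + 2)))) := by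
  rw [← exp_add, ← perturbation_eq hg hM]
  congr 1
  ring

/-! ### Integrability and Gaussian integral bounds -/

theorem integrable_weight {g : ℝ} (hg : 0 ≤ g) :
    Integrable fun x : ℝ => exp (-(x ^ 2 / 2 + g * x ^ 4)) := by
  refine (integrable_exp_neg_mul_sq (b := 1 / 2) (by norm_num)).mono' (by fun_prop) ?_
  refine ae_of_all _ fun x => ?_
  rw [Real.norm_eq_abs, abs_exp]
  apply exp_le_exp.2
  have : 0 ≤ g * x ^ 4 := by positivity
  linarith

theorem integrable_pow_mul_gaussian {b : ℝ} (hb : 0 < b) (n : ℕ) :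
    Integrable fun x : ℝ => x ^ n * exp (-(b * x ^ 2)) := by
  have := integrable_rpow_mul_exp_neg_mul_sq hb (s := n) (by
    have : (0 : ℝ) ≤ n := by positivity
    linarith)
  simpa using this

theorem integrable_gaussian_mul_polynomial {b : ℝ} (hb : 0 < b) (P : Polynomial ℝ) :
    Integrable fun x : ℝ => exp (-(b * x ^ 2)) * P.eval x := by
  simp_rw [Polynomial.eval_eq_sum_range, Finset.mul_sum]
  refine integrable_finsetSum _ fun n _ => ?_
  refine ((integrable_pow_mul_gaussian hb n).const_mul (P.coeff n)).congr (ae_of_all _ fun x => ?_)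
  ring

theorem integrable_approx_integrand {g γ : ℝ} (hγ : 0 < γ) (n : ℕ) :
    Integrable fun x : ℝ => exp (-(γ / 2 * x ^ 2)) *
      ∑ k ∈ range n, (-((1 - γ) / 2 * x ^ 2 + g * x ^ 4)) ^ k / (k.factorial : ℝ) := by
  convert integrable_gaussian_mul_polynomial (half_pos hγ)
    (∑ k ∈ range n, (-(Polynomial.C ((1 - γ) / 2) * Polynomial.X ^ 2 +
      Polynomial.C g * Polynomial.X ^ 4)) ^ k * Polynomial.C ((k.factorial : ℝ)⁻¹)) using 3
  simp [Polynomial.eval_finsetSum, div_eq_mul_inv]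

theorem approx_eq_integral {M : ℕ → ℝ} {N : ℕ} {g : ℝ} (hg : 0 ≤ g) (hM : 0 < M N + 2) :
    approx M N g = ∫ x : ℝ, exp (-(G g (M N) / 2 * x ^ 2)) * ∑ k ∈ range (N + 1),
      (frac g (M N) * (G g (M N) / 2 * x ^ 2 * (1 - G g (M N) / 2 * x ^ 2 / (M N + 2)))) ^ k /
        (k.factorial : ℝ) := by
  unfold approx
  simp_rw [perturbation_eq hg hM]

theorem integrable_approx {g M : ℝ} (hg : 0 ≤ g) (hM : 0 < M + 2) (n : ℕ) :
    Integrable fun x : ℝ => exp (-(G g M / 2 * x ^ 2)) * ∑ k ∈ range n,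
      (frac g M * (G g M / 2 * x ^ 2 * (1 - G g M / 2 * x ^ 2 / (M + 2)))) ^ k /
        (k.factorial : ℝ) := by
  have h1 := one_le_G hg hM.le
  have := integrable_approx_integrand (g := g) (γ := G g M) (by linarith) n
  simpa only [perturbation_eq hg hM] using this

theorem integral_gaussian_half {b : ℝ} :
    ∫ x : ℝ, exp (-(b * x ^ 2)) = √(π / b) := by
  rw [← integral_gaussian b]
  simp_rw [neg_mul]

theorem integrable_gaussian {b : ℝ} (hb : 0 < b) : Integrable fun x : ℝ => exp (-(b * x ^ 2)) := by
  simpa only [neg_mul] using integrable_exp_neg_mul_sq hb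

/-- An integral bound from a pointwise bound by a constant near the origin plus two Gaussians. -/
theorem abs_integral_le_of_box_add_gaussians {f : ℝ → ℝ} {R K C b C' b' : ℝ} (hR : 0 ≤ R)
    (hb : 0 < b) (hb' : 0 < b')
    (hf : ∀ x, |f x| ≤ (Set.Icc (-R) R).indicator (fun _ => K) x +
      (C * exp (-(b * x ^ 2)) + C' * exp (-(b' * x ^ 2)))) :
    |∫ x, f x| ≤ K * (2 * R) + (C * √(π / b) + C' * √(π / b')) := by
  have hi : Integrable ((Set.Icc (-R) R).indicator (fun _ : ℝ => K)) :=
    (integrableOn_const (by simp)).integrable_indicator measurableSet_Icc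
  have hg := (integrable_gaussian hb).const_mul C
  have hg' := (integrable_gaussian hb').const_mul C'
  have hgg : Integrable fun x : ℝ => C * exp (-(b * x ^ 2)) + C' * exp (-(b' * x ^ 2)) :=
    hg.add hg'
  have h1 : ‖∫ x, f x‖ ≤ ∫ x, ((Set.Icc (-R) R).indicator (fun _ => K) x +
      (C * exp (-(b * x ^ 2)) + C' * exp (-(b' * x ^ 2)))) :=
    norm_integral_le_of_norm_le (hi.add hgg) (ae_of_all _ hf)
  rw [Real.norm_eq_abs] at h1
  refine h1.trans (le_of_eq ?_)
  rw [integral_add hi hgg, integral_add hg hg', integral_const_mul, integral_const_mul,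
    integral_gaussian_half, integral_gaussian_half, integral_indicator measurableSet_Icc,
    setIntegral_const]
  simp only [Real.volume_real_Icc, smul_eq_mul]
  rw [max_eq_left (by linarith)]
  ring

/-- An integral bound from a pointwise bound by a constant near the origin plus a Gaussian. -/
theorem abs_integral_le_of_box_add_gaussian {f : ℝ → ℝ} {R K C b : ℝ} (hR : 0 ≤ R)
    (hb : 0 < b)
    (hf : ∀ x, |f x| ≤ (Set.Icc (-R) R).indicator (fun _ => K) x + C * exp (-(b * x ^ 2))) :
    |∫ x, f x| ≤ K * (2 * R) + C * √(π / b) := by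
  have := abs_integral_le_of_box_add_gaussians (C' := 0) hR hb one_pos
    (fun x => by simpa using hf x)
  simpa using this

/-! ### Error bound with constants independent of g -/

theorem tail_remainder_le {c a t m θ : ℝ} {n : ℕ} (hn : n ≠ 0) (hc : 0 < c) (ha : 0 < a)
    (ham : a * n ≤ m) (hmt : m ≤ t) (hθ : 0 ≤ θ) :
    exp (-t) * |exp (θ * (t * (1 - t / m))) -
        ∑ k ∈ range n, (θ * (t * (1 - t / m))) ^ k / (k.factorial : ℝ)| ≤
      θ ^ n * (tangentBase c a ^ n * exp (-(tangentGap c a * t))) := by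
  have hn' : (0 : ℝ) < n := by positivity
  have hm : 0 < m := lt_of_lt_of_le (by positivity) ham
  have ht : 0 < t := hm.trans_le hmt
  have hs1 : 1 ≤ t / m := (one_le_div hm).2 hmt
  have hv : 0 ≤ θ * (t * (t / m - 1)) :=
    mul_nonneg hθ (mul_nonneg ht.le (by linarith))
  have h1 := abs_exp_neg_sub_partial_le n hv
  have h2 : -(θ * (t * (t / m - 1))) = θ * (t * (1 - t / m)) := by ring
  rw [h2] at h1
  have h3 := tail_term_le hn hc ha ham hmt
  calc _ ≤ exp (-t) * ((θ * (t * (t / m - 1))) ^ n / (n.factorial : ℝ)) := by gcongr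
    _ = θ ^ n * (exp (-t) * ((t * (t / m - 1)) ^ n / (n.factorial : ℝ))) := by
      rw [mul_pow]; ring
    _ ≤ _ := by gcongr

/-- The error of the expansion, as the sum of the contributions of the regions `t ≤ m` and
`t ≥ m`, where `t = G x² / 2` and `m = M(N) + 2`. -/
theorem abs_approx_sub_Z_le {M : ℕ → ℝ} {N : ℕ} {g c a : ℝ} (hg : 0 < g) (hc : 0 < c)
    (ha : 0 < a) (hgap : 0 < tangentGap c a) (ham : a * (N + 1) ≤ M N + 2) :
    |approx M N g - Z g| ≤ frac g (M N) ^ (N + 1) *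
      (2 * (1 + (M N + 2) / (N + 1)) ^ 2 * ((M N + 2) / (M N + 2 + (N + 1))) ^ (N + 1) +
        √(2 * π / tangentGap c a) * tangentBase c a ^ (N + 1)) := by
  have hm : 0 < M N + 2 := lt_of_lt_of_le (by positivity) ham
  have hG := one_le_G hg.le hm.le
  have hθ := frac_nonneg hg.le hm.le
  have hθ1 := frac_le_one hg.le hm.le
  have hbase := tangentBase_pos hc ha
  rw [approx_eq_integral hg.le hm, Z]
  simp_rw [weight_eq hg.le hm]
  have hint := integrable_weight hg.le
  simp_rw [weight_eq hg.le hm] at hint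
  rw [← integral_sub (integrable_approx hg.le hm _) hint]
  set m := M N + 2 with hmdef
  set γ := G g (M N) with hγ
  set θ := frac g (M N) with hθdef
  set n : ℕ := N + 1 with hn
  have hncast : (N : ℝ) + 1 = (n : ℝ) := by rw [hn]; push_cast; ring
  rw [hncast] at ham ⊢
  have hn' : (0 : ℝ) < n := by rw [← hncast]; positivity
  have key := abs_integral_le_of_box_add_gaussian (f := fun x : ℝ =>
      exp (-(γ / 2 * x ^ 2)) * ∑ k ∈ range n,
        (θ * (γ / 2 * x ^ 2 * (1 - γ / 2 * x ^ 2 / m))) ^ k / (k.factorial : ℝ) -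
      exp (-(γ / 2 * x ^ 2)) * exp (θ * (γ / 2 * x ^ 2 * (1 - γ / 2 * x ^ 2 / m))))
    (R := √(2 * m)) (K := θ ^ n * ((m / (m + n)) ^ n * ((m + n) / n) / √(2 * π * n)))
    (C := θ ^ n * tangentBase c a ^ n) (b := tangentGap c a / 2) (by positivity) (by positivity)
    (fun x => by
      rw [← mul_sub, abs_mul, abs_exp, abs_sub_comm]
      set t := γ / 2 * x ^ 2 with ht
      have ht0 : 0 ≤ t := by positivity
      -- G ≥ 1 is what makes the box |x| ≤ √(2m) and the leftover Gaussian independent of g.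
      have htx : x ^ 2 / 2 ≤ t := by
        rw [ht]; nlinarith [sq_nonneg x]
      rcases le_total t m with htm | htm
      · have hx : x ∈ Set.Icc (-√(2 * m)) (√(2 * m)) := by
          rw [Set.mem_Icc, ← abs_le]
          apply Real.abs_le_sqrt
          linarith
        rw [Set.indicator_of_mem hx]
        have := head_remainder_le hm (by omega : n ≠ 0) ht0 htm hθ hθ1
        have h2 : 0 ≤ θ ^ n * tangentBase c a ^ n * exp (-(tangentGap c a / 2 * x ^ 2)) := by
          positivity
        linarith
      · have := tail_remainder_le (by omega : n ≠ 0) hc ha ham htm hθ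
        have h2 : 0 ≤ (Set.Icc (-√(2 * m)) (√(2 * m))).indicator (fun _ =>
            θ ^ n * ((m / (m + n)) ^ n * ((m + n) / n) / √(2 * π * n))) x :=
          Set.indicator_nonneg (fun _ _ => by positivity) x
        have h3 : exp (-(tangentGap c a * t)) ≤ exp (-(tangentGap c a / 2 * x ^ 2)) := by
          apply exp_le_exp.2
          nlinarith
        have h4 : θ ^ n * (tangentBase c a ^ n * exp (-(tangentGap c a * t))) ≤
            θ ^ n * tangentBase c a ^ n * exp (-(tangentGap c a / 2 * x ^ 2)) := by
          rw [← mul_assoc]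
          gcongr
        linarith)
  refine key.trans ?_
  have e1 : π / (tangentGap c a / 2) = 2 * π / tangentGap c a := by field_simp
  rw [e1, mul_add (θ ^ n), mul_assoc (θ ^ n), mul_assoc (θ ^ n), mul_comm (tangentBase c a ^ n)]
  refine add_le_add (mul_le_mul_of_nonneg_left ?_ (pow_nonneg hθ n)) le_rfl
  have hu : √(2 * m) / √(2 * π * n) ≤ 1 + m / n := by
    rw [← Real.sqrt_div (by positivity)]
    apply Real.sqrt_le_iff.2
    refine ⟨by positivity, ?_⟩
    have h5 : 2 * m / (2 * π * n) ≤ m / n := by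
      rw [div_le_div_iff₀ (by positivity) hn']
      have : 0 < m * n := by positivity
      nlinarith [pi_gt_three]
    have h6 : 0 < m / n := by positivity
    nlinarith
  calc (m / (m + n)) ^ n * ((m + n) / n) / √(2 * π * n) * (2 * √(2 * m))
      = 2 * ((m + n) / n) * (√(2 * m) / √(2 * π * n)) * (m / (m + n)) ^ n := by ring
    _ ≤ 2 * ((m + n) / n) * (1 + m / n) * (m / (m + n)) ^ n := by gcongr
    _ = _ := by
      have : (m + n) / n = 1 + m / n := by field_simp; ring
      rw [this]; ring

/-! ### Lower bound behind divergence -/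

/-- When `m = M(N) + 2` is small against `N`, the last term of the expansion makes the
approximant exponentially large, with the sign `(-1) ^ N`. -/
theorem exp_le_neg_one_pow_mul_approx {M : ℕ → ℝ} {N : ℕ} {g : ℝ} (hg : 0 < g) (hN : N ≠ 0)
    (hm : 0 < M N + 2) (hmN : 2 * (M N + 2) ≤ N) (hGN : G g (M N) ≤ N)
    (hθ : 2 * exp 3 * (M N + 2) ≤ frac g (M N) * N) :
    exp N / 4 - Z g ≤ (-1 : ℝ) ^ N * approx M N g := by
  have hN' : (0 : ℝ) < N := by positivity
  have hG := one_le_G hg.le hm.le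
  have hθ0 := frac_nonneg hg.le hm.le
  rw [approx_eq_integral hg.le hm, Z]
  simp_rw [weight_eq hg.le hm]
  have hint := integrable_weight hg.le
  simp_rw [weight_eq hg.le hm] at hint
  have hint2 := (integrable_approx hg.le hm (N + 1)).const_mul ((-1 : ℝ) ^ N)
  -- Adding the integrand of Z makes the total nonnegative everywhere, by `neg_exp_le_partial`, so
  -- the integral may be restricted to a window.
  rw [sub_le_iff_le_add', ← integral_const_mul, ← integral_add hint hint2]
  set m := M N + 2 with hmdef
  set γ := G g (M N) with hγ
  set θ := frac g (M N) with hθdef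
  set s := √(2 * N / γ) with hs
  have hγ0 : 0 < γ := by linarith
  have hs2 : s ^ 2 = 2 * N / γ := Real.sq_sqrt (by positivity)
  -- G ≤ N gives s² ≥ 2. The point x = s is t = N, and s ≥ 1.4 ensures (s + 1/2)² ≤ 2s², so N ≤ t ≤
  -- 2N on the window [s, s + 1/2].
  have hs1 : 1.4 ≤ s := by
    apply Real.le_sqrt_of_sq_le
    rw [le_div_iff₀ hγ0]
    nlinarith
  have hi : Integrable ((Set.Icc s (s + 1 / 2)).indicator (fun _ : ℝ => exp N / 2)) :=
    (integrableOn_const (by simp)).integrable_indicator measurableSet_Icc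
  have hval : ∫ x, (Set.Icc s (s + 1 / 2)).indicator (fun _ : ℝ => exp N / 2) x = exp N / 4 := by
    rw [integral_indicator measurableSet_Icc, setIntegral_const]
    simp only [Real.volume_real_Icc, smul_eq_mul]
    rw [max_eq_left (by linarith)]
    ring
  rw [← hval]
  refine integral_mono hi (hint.add hint2) fun x => ?_
  beta_reduce
  set t := γ / 2 * x ^ 2 with ht
  set w := θ * (t * (1 - t / m)) with hw
  have hfactor : exp (-t) * exp w + (-1 : ℝ) ^ N * (exp (-t) *
      ∑ k ∈ range (N + 1), w ^ k / (k.factorial : ℝ)) =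
      exp (-t) * (exp w + (-1 : ℝ) ^ N * ∑ k ∈ range (N + 1), w ^ k / (k.factorial : ℝ)) := by
    ring
  rw [hfactor]
  by_cases hx : x ∈ Set.Icc s (s + 1 / 2)
  · rw [Set.indicator_of_mem hx]
    have hxl : s ^ 2 ≤ x ^ 2 := pow_le_pow_left₀ (by linarith) hx.1 2
    have hxu : x ^ 2 ≤ 2 * s ^ 2 := by
      have := pow_le_pow_left₀ (by linarith [hx.1]) hx.2 2
      nlinarith
    have hγs : γ / 2 * s ^ 2 = N := by rw [hs2]; field_simp
    have htl : (N : ℝ) ≤ t := by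
      rw [← hγs, ht]; gcongr
    have htu : t ≤ 2 * N := by
      rw [← hγs, ht]; nlinarith
    -- With e³ here, the half last term is at least e^{3N}/2 because N! ≤ N^N; the weight e^{-t} ≥
    -- e^{-2N} leaves e^N/2.
    have hv : exp 3 * N ≤ -w := by
      have h1 : -w = θ * (t * ((t - m) / m)) := by rw [hw]; field_simp; ring
      have h2 : N / (2 * m) ≤ (t - m) / m := by
        rw [div_le_div_iff₀ (by positivity) hm]
        nlinarith
      calc exp 3 * N ≤ θ * (N * (N / (2 * m))) := by
            have : θ * (N * (N / (2 * m))) = (θ * N) / (2 * m) * N := by ring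
            rw [this]
            gcongr
            rw [le_div_iff₀ (by positivity)]
            linarith
        _ ≤ θ * (t * ((t - m) / m)) := by gcongr
        _ = -w := h1.symm
    have he3 : (2 : ℝ) ≤ exp 3 := by linarith [add_one_le_exp (3 : ℝ)]
    have h3 := half_last_term_le_partial N (v := -w) (by nlinarith)
    rw [neg_neg] at h3
    have h4 : exp 3 ^ N / 2 ≤ (-w) ^ N / (2 * (N.factorial : ℝ)) := by
      rw [div_le_div_iff₀ (by norm_num) (by positivity)]
      have h5 : (N.factorial : ℝ) ≤ (N : ℝ) ^ N := by exact_mod_cast Nat.factorial_le_pow N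
      have h6 : exp 3 ^ N * (N : ℝ) ^ N ≤ (-w) ^ N := by
        rw [← mul_pow]
        exact pow_le_pow_left₀ (by positivity) hv N
      have h7 : exp 3 ^ N * (N.factorial : ℝ) ≤ exp 3 ^ N * (N : ℝ) ^ N := by gcongr
      linarith
    calc exp N / 2 = exp (-(2 * N)) * (exp 3 ^ N / 2) := by
          rw [← exp_nat_mul, ← mul_div_assoc, ← exp_add]
          congr 2
          ring
      _ ≤ exp (-t) * (exp w + (-1 : ℝ) ^ N * ∑ k ∈ range (N + 1), w ^ k / (k.factorial : ℝ)) := by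
          gcongr
          exact h4.trans h3
  · rw [Set.indicator_of_notMem hx]
    have := neg_exp_le_partial N w
    exact mul_nonneg (exp_pos _).le (by linarith)

/-! ### Size of the approximant when G is large -/

/-- Halving t costs 2^k ≤ 2^N in the k-th term, and the halved exponent leaves room for decay
against e^{-t}. -/
theorem partial_exp_le_two_pow_mul (N : ℕ) {t : ℝ} (ht : 0 ≤ t) :
    ∑ k ∈ range (N + 1), t ^ k / (k.factorial : ℝ) ≤ 2 ^ N * exp (t / 2) := by
  refine le_trans ?_ (mul_le_mul_of_nonneg_left
    (partial_exp_le_exp (N + 1) (by positivity : 0 ≤ t / 2)) (by positivity))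
  rw [Finset.mul_sum]
  refine Finset.sum_le_sum fun k hk => ?_
  have hkN : k ≤ N := by
    have := Finset.mem_range.1 hk
    omega
  calc t ^ k / (k.factorial : ℝ) = 2 ^ k * ((t / 2) ^ k / (k.factorial : ℝ)) := by
        rw [div_pow]; field_simp
    _ ≤ 2 ^ N * ((t / 2) ^ k / (k.factorial : ℝ)) := by
        gcongr
        norm_num

/-- Against the weight `exp (-t)` the partial sum is at most `1`, and small beyond `4 N`. -/
theorem exp_neg_mul_partial_le {N : ℕ} {t w : ℝ} (hw : 0 ≤ w) (hwt : w ≤ t) :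
    exp (-t) * ∑ k ∈ range (N + 1), w ^ k / (k.factorial : ℝ) ≤ 1 ∧
    (4 * (N : ℝ) ≤ t →
      exp (-t) * ∑ k ∈ range (N + 1), w ^ k / (k.factorial : ℝ) ≤ exp (-(t / 4))) := by
  have h0 : ∑ k ∈ range (N + 1), w ^ k / (k.factorial : ℝ) ≤
      ∑ k ∈ range (N + 1), t ^ k / (k.factorial : ℝ) := by
    gcongr
  have ht := hw.trans hwt
  constructor
  · calc _ ≤ exp (-t) * exp t := by
          gcongr
          exact h0.trans (partial_exp_le_exp _ ht)
      _ = 1 := by rw [← exp_add]; simp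
  · intro htN
    have h2 : (2 : ℝ) ^ N ≤ exp N := by
      have : (2 : ℝ) ≤ exp 1 := by linarith [add_one_le_exp (1 : ℝ)]
      calc (2 : ℝ) ^ N ≤ exp 1 ^ N := by gcongr
        _ = exp N := by rw [← exp_nat_mul, mul_one]
    calc _ ≤ exp (-t) * (exp N * exp (t / 2)) := by
          gcongr
          refine h0.trans ((partial_exp_le_two_pow_mul N ht).trans ?_)
          gcongr
      _ = exp (-t + (N + t / 2)) := by rw [← exp_add, ← exp_add]
      _ ≤ _ := by
          apply exp_le_exp.2
          linarith

/-- A bound on the size of the approximant that decays when `G` grows faster than `N`. -/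
theorem abs_approx_le {M : ℕ → ℝ} {N : ℕ} {g c a : ℝ} (hg : 0 < g) (hc : 0 < c)
    (ha : 0 < a) (hgap : 0 < tangentGap c a) (ham : a * (N + 1) ≤ M N + 2) :
    |approx M N g| ≤ 2 * √(8 * N / G g (M N)) + √(8 * π / G g (M N)) +
        √(2 * π / tangentGap c a) * tangentBase c a ^ (N + 1) := by
  have hm : 0 < M N + 2 := lt_of_lt_of_le (by positivity) ham
  have hG := one_le_G hg.le hm.le
  have hθ := frac_nonneg hg.le hm.le
  have hθ1 := frac_le_one hg.le hm.le
  have hbase := tangentBase_pos hc ha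
  rw [approx_eq_integral hg.le hm]
  set m := M N + 2 with hmdef
  set γ := G g (M N) with hγ
  set θ := frac g (M N) with hθdef
  have hγ0 : 0 < γ := by linarith
  -- The box |x| ≤ R is t ≤ 4N, where only the bound 1 is available.
  set R := √(8 * N / γ) with hR
  have hR2 : R ^ 2 = 8 * N / γ := Real.sq_sqrt (by positivity)
  have key := abs_integral_le_of_box_add_gaussians (f := fun x : ℝ =>
      exp (-(γ / 2 * x ^ 2)) * ∑ k ∈ range (N + 1),
        (θ * (γ / 2 * x ^ 2 * (1 - γ / 2 * x ^ 2 / m))) ^ k / (k.factorial : ℝ))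
    (R := R) (K := 1) (C := 1) (b := γ / 8)
    (C' := tangentBase c a ^ (N + 1)) (b' := tangentGap c a / 2)
    (by positivity) (by positivity) (by positivity)
    (fun x => by
      rw [abs_mul, abs_exp, one_mul]
      set t := γ / 2 * x ^ 2 with ht
      have ht0 : 0 ≤ t := by positivity
      have htx : x ^ 2 / 2 ≤ t := by
        rw [ht]; nlinarith [sq_nonneg x]
      have ht4 : γ / 8 * x ^ 2 = t / 4 := by rw [ht]; ring
      rw [ht4]
      have hind : 0 ≤ (Set.Icc (-R) R).indicator (fun _ => (1 : ℝ)) x :=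
        Set.indicator_nonneg (fun _ _ => zero_le_one) x
      have hgauss : 0 ≤ tangentBase c a ^ (N + 1) * exp (-(tangentGap c a / 2 * x ^ 2)) := by
        positivity
      have hexp4 : 0 < exp (-(t / 4)) := exp_pos _
      rcases le_total t m with htm | htm
      · have hw0 : 0 ≤ t * (1 - t / m) :=
          mul_nonneg ht0 (sub_nonneg.2 ((div_le_one hm).2 htm))
        have hw : 0 ≤ θ * (t * (1 - t / m)) := mul_nonneg hθ hw0
        have hwt : θ * (t * (1 - t / m)) ≤ t := by
          have h1 : θ * (t * (1 - t / m)) ≤ t * (1 - t / m) := mul_le_of_le_one_left hw0 hθ1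
          have h2 : t * (1 - t / m) ≤ t := by
            apply mul_le_of_le_one_right ht0
            have : 0 ≤ t / m := by positivity
            linarith
          exact h1.trans h2
        obtain ⟨b1, b2⟩ := exp_neg_mul_partial_le (N := N) hw hwt
        rw [abs_of_nonneg (Finset.sum_nonneg fun k _ => by positivity)]
        rcases le_total (4 * (N : ℝ)) t with h4 | h4
        · have := b2 h4
          linarith
        · have hx : x ∈ Set.Icc (-R) R := by
            rw [Set.mem_Icc, ← abs_le]
            apply Real.abs_le_sqrt
            rw [le_div_iff₀ hγ0]
            rw [ht] at h4
            linarith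
          rw [Set.indicator_of_mem hx]
          linarith
      · have h1 := tail_remainder_le (n := N + 1) (by omega) hc ha
          (by push_cast; exact ham) htm hθ
        set w := θ * (t * (1 - t / m)) with hw
        set S := ∑ k ∈ range (N + 1), w ^ k / (k.factorial : ℝ) with hS
        have hw0 : w ≤ 0 := by
          apply mul_nonpos_of_nonneg_of_nonpos hθ
          apply mul_nonpos_of_nonneg_of_nonpos ht0
          linarith [(one_le_div hm).2 htm]
        have h2 : |S| ≤ 1 + |exp w - S| := by
          have h3 := abs_sub_abs_le_abs_sub S (exp w)
          rw [abs_sub_comm, abs_exp] at h3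
          have := exp_le_one_iff.2 hw0
          linarith
        have h3 : exp (-(tangentGap c a * t)) ≤ exp (-(tangentGap c a / 2 * x ^ 2)) := by
          apply exp_le_exp.2
          nlinarith
        have h4 : θ ^ (N + 1) * (tangentBase c a ^ (N + 1) * exp (-(tangentGap c a * t))) ≤
            tangentBase c a ^ (N + 1) * exp (-(tangentGap c a / 2 * x ^ 2)) := by
          refine (mul_le_of_le_one_left (by positivity) (pow_le_one₀ hθ hθ1)).trans ?_
          gcongr
        have h5 : exp (-t) ≤ exp (-(t / 4)) := exp_le_exp.2 (by linarith)
        have h6 : exp (-t) * |S| ≤ exp (-t) + exp (-t) * |exp w - S| := by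
          nlinarith [exp_pos (-t)]
        linarith)
  refine key.trans (le_of_eq ?_)
  have e1 : π / (tangentGap c a / 2) = 2 * π / tangentGap c a := by field_simp
  have e2 : π / (γ / 8) = 8 * π / γ := by field_simp
  rw [e1, e2]
  ring

/-! ### The two bases: monotonicity, crossings, numerical comparison -/

theorem tailBase_pos {α : ℝ} (hα : 0 < α) : 0 < tailBase α := by
  unfold tailBase; positivity

theorem headBase_pos {α : ℝ} (hα : 0 < α) : 0 < headBase α := by
  unfold headBase; positivity

theorem headBase_lt_one {α : ℝ} (hα : 0 < α) : headBase α < 1 := by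
  unfold headBase
  rw [div_lt_one (by linarith)]
  linarith

theorem headBase_strictMonoOn : StrictMonoOn headBase (Set.Ioi 0) := by
  intro a ha b hb hab
  unfold headBase
  have ha' : (0 : ℝ) < a := ha
  have hb' : (0 : ℝ) < b := hb
  rw [div_lt_div_iff₀ (by linarith) (by linarith)]
  nlinarith

theorem tailBase_strictAntiOn : StrictAntiOn tailBase (Set.Ioi 0) := by
  intro a ha b hb hab
  have ha' : (0 : ℝ) < a := ha
  have hb' : (0 : ℝ) < b := hb
  unfold tailBase
  have h1 : 2 / b < 2 / a := by gcongr
  have h2 : a ^ 2 / (a + 2) < b ^ 2 / (b + 2) := by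
    rw [div_lt_div_iff₀ (by linarith) (by linarith)]
    have : 0 < a * b := by positivity
    nlinarith
  have h3 : exp (-1 - b / 2 - b ^ 2 / (b + 2)) < exp (-1 - a / 2 - a ^ 2 / (a + 2)) := by
    apply exp_lt_exp.2
    linarith
  have : (0 : ℝ) < 2 / b := by positivity
  gcongr

theorem continuousOn_tailBase : ContinuousOn tailBase (Set.Ioi 0) := by
  unfold tailBase
  intro x hx
  have hx' : (0 : ℝ) < x := hx
  have h1 : x ≠ 0 := hx'.ne'
  have h2 : x + 2 ≠ 0 := by positivity
  apply ContinuousAt.continuousWithinAt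
  fun_prop (disch := assumption)

theorem continuousOn_headBase : ContinuousOn headBase (Set.Ioi 0) := by
  unfold headBase
  intro x hx
  have hx' : (0 : ℝ) < x := hx
  have h2 : x + 1 ≠ 0 := by positivity
  apply ContinuousAt.continuousWithinAt
  fun_prop (disch := assumption)

/-- Writing exp x = exp(x/4)^4 brings every exponent needed below into the range |x/4| ≤ 1 of the
Taylor estimate. -/
theorem lt_exp_of_taylor {x l : ℝ} (n : ℕ) (hn : 0 < n) (hx : |x / 4| ≤ 1) (hl0 : 0 ≤ l)
    (hl : l < ∑ k ∈ Finset.range n, (x / 4) ^ k / (k.factorial : ℝ) -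
      |x / 4| ^ n * ((n.succ : ℝ) / (n.factorial * n))) : l ^ 4 < exp x := by
  have h := abs_le.1 (Real.exp_bound hx hn)
  have h1 : l < exp (x / 4) := by linarith [h.1]
  have h2 : exp x = exp (x / 4) ^ 4 := by
    rw [← exp_nat_mul]; congr 1; push_cast; ring
  rw [h2]
  gcongr

theorem exp_lt_of_taylor {x u : ℝ} (n : ℕ) (hn : 0 < n) (hx : |x / 4| ≤ 1)
    (hu : ∑ k ∈ Finset.range n, (x / 4) ^ k / (k.factorial : ℝ) +
      |x / 4| ^ n * ((n.succ : ℝ) / (n.factorial * n)) < u) : exp x < u ^ 4 := by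
  have h := abs_le.1 (Real.exp_bound hx hn)
  have h1 : exp (x / 4) < u := by linarith [h.2]
  have h2 : exp x = exp (x / 4) ^ 4 := by
    rw [← exp_nat_mul]; congr 1; push_cast; ring
  rw [h2]
  have := exp_pos (x / 4)
  gcongr

theorem one_lt_tailBase_left : 1 < tailBase 0.9755 := by
  have h : (0.63635 : ℝ) ^ 4 < exp (-1 - 0.9755 / 2 - 0.9755 ^ 2 / (0.9755 + 2)) :=
    lt_exp_of_taylor 8 (by norm_num) (by norm_num [abs_le]) (by norm_num)
      (by norm_num [Finset.sum_range_succ, Nat.factorial, abs_of_neg, abs_of_pos])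
  unfold tailBase
  norm_num at h ⊢
  linarith

theorem tailBase_right_lt_one : tailBase 0.9765 < 1 := by
  have h : exp (-1 - 0.9765 / 2 - 0.9765 ^ 2 / (0.9765 + 2)) < (0.6363 : ℝ) ^ 4 :=
    exp_lt_of_taylor 8 (by norm_num) (by norm_num [abs_le])
      (by norm_num [Finset.sum_range_succ, Nat.factorial, abs_of_neg, abs_of_pos])
  unfold tailBase
  norm_num at h ⊢
  linarith

theorem headBase_lt_tailBase_left : headBase 1.3165 < tailBase 1.3165 := by
  have h : (0.5796 : ℝ) ^ 4 < exp (-1 - 1.3165 / 2 - 1.3165 ^ 2 / (1.3165 + 2)) :=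
    lt_exp_of_taylor 8 (by norm_num) (by norm_num [abs_le]) (by norm_num)
      (by norm_num [Finset.sum_range_succ, Nat.factorial, abs_of_neg, abs_of_pos])
  unfold tailBase headBase
  norm_num at h ⊢
  linarith

theorem tailBase_lt_headBase_right : tailBase 1.3175 < headBase 1.3175 := by
  have h : exp (-1 - 1.3175 / 2 - 1.3175 ^ 2 / (1.3175 + 2)) < (0.57961 : ℝ) ^ 4 :=
    exp_lt_of_taylor 8 (by norm_num) (by norm_num [abs_le])
      (by norm_num [Finset.sum_range_succ, Nat.factorial, abs_of_neg, abs_of_pos])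
  unfold tailBase headBase
  norm_num at h ⊢
  linarith

theorem exists_tailBase_eq_one : ∃ α, 0.9755 < α ∧ α < 0.9765 ∧ tailBase α = 1 := by
  have hc : ContinuousOn tailBase (Set.Icc 0.9755 0.9765) :=
    continuousOn_tailBase.mono fun x hx => lt_of_lt_of_le (by norm_num) hx.1
  obtain ⟨α, hα, h⟩ := intermediate_value_Ioo' (by norm_num) hc
    ⟨tailBase_right_lt_one, one_lt_tailBase_left⟩
  exact ⟨α, hα.1, hα.2, h⟩

theorem exists_tailBase_eq_headBase :
    ∃ α, 1.3165 < α ∧ α < 1.3175 ∧ tailBase α = headBase α := by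
  have hsub : Set.Icc (1.3165 : ℝ) 1.3175 ⊆ Set.Ioi 0 :=
    fun x hx => lt_of_lt_of_le (by norm_num) hx.1
  have hc : ContinuousOn (fun α => tailBase α - headBase α) (Set.Icc 1.3165 1.3175) :=
    (continuousOn_tailBase.mono hsub).sub (continuousOn_headBase.mono hsub)
  obtain ⟨α, hα, h⟩ := intermediate_value_Ioo' (by norm_num) hc
    (show (0 : ℝ) ∈ Set.Ioo _ _ from
      ⟨sub_neg.2 tailBase_lt_headBase_right, sub_pos.2 headBase_lt_tailBase_left⟩)
  exact ⟨α, hα.1, hα.2, sub_eq_zero.1 h⟩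

/-- The comparison of the tangent bound with `tailBase` only has to be checked at the right end
of an interval. -/
theorem tangentBase_lt_tailBase {c α β : ℝ} (hc : 1.5 ≤ c) (hc2 : c ≤ 2) (hα : 0.9 ≤ α)
    (hαβ : α ≤ β) (h : c * (β + c) / (2 * (2 + β)) < exp (β / c - β / 2 - β ^ 2 / (β + 2))) :
    tangentBase c α < tailBase α := by
  have hα0 : 0 < α := by linarith
  have hβ0 : 0 < β := by linarith
  have hc0 : 0 < c := by linarith
  have h1 : c * (α + c) / (2 * (2 + α)) ≤ c * (β + c) / (2 * (2 + β)) := by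
    rw [div_le_div_iff₀ (by positivity) (by positivity)]
    nlinarith [mul_nonneg (mul_nonneg hc0.le (sub_nonneg.2 hαβ)) (sub_nonneg.2 hc2)]
  -- The exponent decreases in α: 1/c - 1/2 ≤ 1/6 since c ≥ 3/2, while α²/(α+2) grows with slope at
  -- least 1/6 here.
  have h2 : β / c - β / 2 - β ^ 2 / (β + 2) ≤ α / c - α / 2 - α ^ 2 / (α + 2) := by
    have h3 : (β - α) / c ≤ (β - α) * (2 / 3) := by
      rw [div_le_iff₀ hc0]
      nlinarith
    have h4 : (β - α) * (1 / 6) ≤ β ^ 2 / (β + 2) - α ^ 2 / (α + 2) := by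
      rw [div_sub_div _ _ (by positivity) (by positivity), le_div_iff₀ (by positivity)]
      have h5 : 0 ≤ (β - α) * (5 * (α * β + 2 * α + 2 * β) - 4) := by
        apply mul_nonneg (by linarith)
        nlinarith [mul_pos hα0 hβ0]
      nlinarith
    rw [sub_div] at h3
    linarith
  have h6 := (h1.trans_lt h).trans_le (exp_le_exp.2 h2)
  have h7 : exp (α / c - α / 2 - α ^ 2 / (α + 2)) =
      exp (-1 - α / 2 - α ^ 2 / (α + 2)) / exp (-1 - α / c) := by
    rw [← exp_sub]; congr 1; ring
  rw [h7, lt_div_iff₀ (exp_pos _), div_mul_eq_mul_div, div_lt_iff₀ (by positivity)] at h6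
  unfold tangentBase tailBase
  have e1 : c * (1 + c / α) = c * (α + c) / α := by field_simp
  have e2 : 2 * (2 / α + 1) = 2 * (2 + α) / α := by field_simp
  rw [e1, e2, div_mul_eq_mul_div, div_mul_eq_mul_div]
  exact (div_lt_div_iff_of_pos_right hα0).2 (by linarith)

theorem tangentGap_pos_of_le {c a b : ℝ} (hc : 0 < c) (ha : 0 < a) (h : 0 < tangentGap c a)
    (hab : a ≤ b) : 0 < tangentGap c b :=
  h.trans_le (tangentGap_monotone hc ha hab)

/-- `tangentBase` increases in c, so the best c is the smallest one with a positive gap. Each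
interval uses a fixed c slightly above the zero of the gap at its left end, as the gap grows with α.
Past 1.3175 the comparison is with `headBase`, which increases while `tangentBase` decreases. -/
theorem exists_tangentBase_lt_max {α : ℝ} (hα : 0.9755 ≤ α) :
    ∃ c, 0 < c ∧ 0 < tangentGap c α ∧ tangentBase c α < max (tailBase α) (headBase α) := by
  rcases le_or_gt α 1.1 with h1 | h1
  · refine ⟨1.63, by norm_num, tangentGap_pos_of_le (by norm_num)
      (by norm_num : (0 : ℝ) < 0.9755) (by norm_num [tangentGap]) hα, lt_max_of_lt_left ?_⟩
    refine tangentBase_lt_tailBase (by norm_num) (by norm_num) (by linarith) h1 ?_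
    refine lt_trans ?_ (lt_exp_of_taylor (l := 0.93) 6 (by norm_num) (by norm_num [abs_le])
      (by norm_num) (by norm_num [Finset.sum_range_succ, Nat.factorial, abs_of_neg, abs_of_pos]))
    norm_num
  rcases le_or_gt α 1.28 with h2 | h2
  · refine ⟨1.6, by norm_num, tangentGap_pos_of_le (by norm_num)
      (by norm_num : (0 : ℝ) < 1.1) (by norm_num [tangentGap]) h1.le, lt_max_of_lt_left ?_⟩
    refine tangentBase_lt_tailBase (by norm_num) (by norm_num) (by linarith) h2 ?_
    refine lt_trans ?_ (lt_exp_of_taylor (l := 0.917) 6 (by norm_num) (by norm_num [abs_le])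
      (by norm_num) (by norm_num [Finset.sum_range_succ, Nat.factorial, abs_of_neg, abs_of_pos]))
    norm_num
  refine ⟨1.55, by norm_num, tangentGap_pos_of_le (by norm_num)
    (by norm_num : (0 : ℝ) < 1.28) (by norm_num [tangentGap]) h2.le, ?_⟩
  rcases le_or_gt α 1.3175 with h3 | h3
  · refine lt_max_of_lt_left ?_
    refine tangentBase_lt_tailBase (by norm_num) (by norm_num) (by linarith) h3 ?_
    refine lt_trans ?_ (lt_exp_of_taylor (l := 0.915) 6 (by norm_num) (by norm_num [abs_le])
      (by norm_num) (by norm_num [Finset.sum_range_succ, Nat.factorial, abs_of_neg, abs_of_pos]))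
    norm_num
  · refine lt_max_of_lt_right ?_
    have h4 : exp (-1 - 1.3175 / 1.55) < (0.635 : ℝ) ^ 4 :=
      exp_lt_of_taylor 6 (by norm_num) (by norm_num [abs_le])
        (by norm_num [Finset.sum_range_succ, Nat.factorial, abs_of_neg, abs_of_pos])
    calc tangentBase 1.55 α ≤ tangentBase 1.55 1.3175 :=
          tangentBase_antitone (by norm_num) (by norm_num) h3.le
      _ < headBase 1.3175 := by
          unfold tangentBase headBase
          norm_num at h4 ⊢
          linarith
      _ < headBase α := headBase_strictMonoOn (by norm_num) (lt_trans (by norm_num) h3) h3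

/-- This single pair controls the tail whenever M(N) ≥ 0.9755 N; it serves the cases 1 ≤ p < 2 and p
> 2. -/
theorem tangentGap_critical_pos : 0 < tangentGap 1.63 0.9755 := by
  norm_num [tangentGap]

theorem tangentBase_critical_lt_one : tangentBase 1.63 0.9755 < 1 := by
  have h : exp (-1 - 0.9755 / 1.63) < (0.675 : ℝ) ^ 4 :=
    exp_lt_of_taylor 6 (by norm_num) (by norm_num [abs_le])
      (by norm_num [Finset.sum_range_succ, Nat.factorial, abs_of_neg, abs_of_pos])
  unfold tangentBase
  norm_num at h ⊢
  linarith

theorem max_base_pos {α : ℝ} (hα : 0 < α) : 0 < max (tailBase α) (headBase α) :=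
  lt_max_of_lt_left (tailBase_pos hα)

theorem rateA_eq_of_le {α β : ℝ} (hα : 0 < α) (hαβ : α ≤ β) (hβ : tailBase β = headBase β) :
    rateA α = -logb 10 (tailBase α) := by
  unfold rateA
  have hβ0 := hα.trans_le hαβ
  rw [max_eq_left]
  calc headBase α ≤ headBase β := headBase_strictMonoOn.monotoneOn hα hβ0 hαβ
    _ = tailBase β := hβ.symm
    _ ≤ tailBase α := tailBase_strictAntiOn.antitoneOn hα hβ0 hαβ

theorem rateA_eq_of_ge {α β : ℝ} (hβ0 : 0 < β) (hαβ : β ≤ α) (hβ : tailBase β = headBase β) :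
    rateA α = -logb 10 (headBase α) := by
  unfold rateA
  have hα := hβ0.trans_le hαβ
  rw [max_eq_right]
  calc tailBase α ≤ tailBase β := tailBase_strictAntiOn.antitoneOn hβ0 hα hαβ
    _ = headBase β := hβ
    _ ≤ headBase α := headBase_strictMonoOn.monotoneOn hβ0 hα hαβ

/-- The maximum of a decreasing and an increasing function is least where they cross. -/
theorem rateA_lt_of_ne {α β : ℝ} (hα : 0 < α) (hβ0 : 0 < β) (hβ : tailBase β = headBase β)
    (hne : α ≠ β) : rateA α < rateA β := by
  rcases lt_or_gt_of_ne hne with h | h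
  · rw [rateA_eq_of_le hα h.le hβ, rateA_eq_of_le hβ0 le_rfl hβ, neg_lt_neg_iff]
    exact logb_lt_logb (by norm_num) (tailBase_pos hβ0) (tailBase_strictAntiOn hα hβ0 h)
  · rw [rateA_eq_of_ge hβ0 h.le hβ, rateA_eq_of_ge hβ0 le_rfl hβ, neg_lt_neg_iff]
    exact logb_lt_logb (by norm_num) (headBase_pos hβ0) (headBase_strictMonoOn hβ0 hα h)

theorem rateA_optimal_bounds {β : ℝ} (h1 : 1.3165 < β) (h2 : β < 1.3175)
    (hβ : tailBase β = headBase β) : 0.245 ≤ rateA β ∧ rateA β ≤ 0.2455 := by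
  have hβ0 : 0 < β := by linarith
  rw [rateA_eq_of_ge hβ0 le_rfl hβ, ← logb_inv]
  have e : (headBase β)⁻¹ = 1 + 1 / β := by
    unfold headBase; field_simp
  rw [e]
  have hl : 1.759 ≤ 1 + 1 / β := by
    have : (0.759 : ℝ) ≤ 1 / β := by
      rw [le_div_iff₀ hβ0]; linarith
    linarith
  have hu : 1 + 1 / β ≤ 1.7596 := by
    have : 1 / β ≤ (0.7596 : ℝ) := by
      rw [div_le_iff₀ hβ0]; linarith
    linarith
  -- Integer powers replace logarithms: 0.245 < 25/102 and 27/110 < 0.2455.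
  have hlog : ∀ (k : ℕ), logb 10 ((10 : ℝ) ^ k) = k := fun k => by
    rw [logb_pow, logb_self_eq_one (by norm_num), mul_one]
  constructor
  · have h : logb 10 ((10 : ℝ) ^ 25) ≤ logb 10 ((1 + 1 / β) ^ 102) := by
      refine logb_le_logb_of_le (by norm_num) (by norm_num) ?_
      calc (10 : ℝ) ^ 25 ≤ 1.759 ^ 102 := by norm_num
        _ ≤ _ := by gcongr
    rw [hlog, logb_pow] at h
    norm_num at h ⊢
    linarith
  · have h : logb 10 ((1 + 1 / β) ^ 110) ≤ logb 10 ((10 : ℝ) ^ 27) := by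
      refine logb_le_logb_of_le (by norm_num) (by positivity) ?_
      calc (1 + 1 / β) ^ 110 ≤ (1.7596 : ℝ) ^ 110 := by gcongr
        _ ≤ (10 : ℝ) ^ 27 := by norm_num
    rw [hlog, logb_pow] at h
    norm_num at h ⊢
    linarith

/-! ### Decimal rates and the factor θ^n -/

theorem rpow_neg_rateA_mul {α : ℝ} (hα : 0 < α) (N : ℕ) :
    (10 : ℝ) ^ (-rateA α * N) = max (tailBase α) (headBase α) ^ N := by
  unfold rateA
  rw [neg_neg, rpow_mul (by norm_num), rpow_logb (by norm_num) (by norm_num) (max_base_pos hα),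
    rpow_natCast]

theorem rateA_pos_of_max_lt_one {α : ℝ} (hα : 0 < α) (h : max (tailBase α) (headBase α) < 1) :
    0 < rateA α :=
  neg_pos.2 (logb_neg (by norm_num) (max_base_pos hα) h)

/-- From 1 - u ≤ e^{-u}. As G grows like √(gM), this is the source of the stretched exponential. -/
theorem frac_pow_le {g M : ℝ} (hg : 0 ≤ g) (hM : 0 ≤ M + 2) (n : ℕ) :
    frac g M ^ n ≤ exp (-(n / G g M)) := by
  have h1 : frac g M ≤ exp (-(1 / G g M)) := by
    unfold frac
    linarith [add_one_le_exp (-(1 / G g M))]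
  calc frac g M ^ n ≤ exp (-(1 / G g M)) ^ n := pow_le_pow_left₀ (frac_nonneg hg hM) h1 n
    _ = _ := by rw [← exp_nat_mul]; congr 1; ring

theorem G_mono {g M M' : ℝ} (hg : 0 ≤ g) (h : M ≤ M') : G g M ≤ G g M' := by
  unfold G
  gcongr

theorem frac_mono {g M M' : ℝ} (hg : 0 ≤ g) (hM : 0 ≤ M + 2) (h : M ≤ M') :
    frac g M ≤ frac g M' := by
  have h1 := one_le_G hg hM
  have h2 := G_mono hg h
  unfold frac
  gcongr

theorem frac_pos {g M : ℝ} (hg : 0 < g) (hM : 0 < M + 2) : 0 < frac g M := by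
  have h1 := one_le_G hg.le hM.le
  have h2 := G_mul_sub_one hg.le hM.le
  have h3 : 0 < 4 * g * (M + 2) := by positivity
  unfold frac
  rw [sub_pos, div_lt_one (by linarith)]
  nlinarith

theorem half_le_frac {g M : ℝ} (h : 2 ≤ G g M) : 1 / 2 ≤ frac g M := by
  unfold frac
  have : 1 / G g M ≤ 1 / 2 := by gcongr
  linarith

/-! ### Divergence when `M(N)` is small against `N` -/

theorem tendsto_neg_one_pow_mul_approx_atTop {M : ℕ → ℝ} {g : ℝ} (hg : 0 < g)
    (h : ∀ᶠ N : ℕ in atTop, 0 < M N + 2 ∧ 2 * (M N + 2) ≤ N ∧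
      2 * exp 3 * (M N + 2) ≤ frac g (M N) * N) :
    Tendsto (fun N : ℕ => (-1 : ℝ) ^ N * approx M N g) atTop atTop := by
  have hexp : Tendsto (fun N : ℕ => exp N / 4 - Z g) atTop atTop :=
    tendsto_atTop_add_const_right _ _
      ((tendsto_exp_atTop.comp tendsto_natCast_atTop_atTop).atTop_div_const (by norm_num))
  refine tendsto_atTop_mono' _ ?_ hexp
  filter_upwards [h, eventually_ge_atTop 1,
    tendsto_natCast_atTop_atTop.eventually_ge_atTop (2 * g + 2)] with N hN hN1 hNg
  refine exp_le_neg_one_pow_mul_approx hg (by omega) hN.1 hN.2.1 ?_ hN.2.2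
  have h1 := G_le hg.le hN.1.le
  -- Aim: G ≤ 1 + 2√(gm) ≤ N. With m ≤ N/2 it suffices that 2gN ≤ (N - 1)², which follows from N ≥
  -- 2g + 2.
  have h2 : √(g * (M N + 2)) ≤ (N - 1) / 2 := by
    apply Real.sqrt_le_iff.2
    have h3 : g * (M N + 2) ≤ g * (N / 2) := by
      gcongr
      linarith [hN.2.1]
    constructor
    · linarith
    · nlinarith
  linarith

theorem eventually_add_two_le_mul {M : ℕ → ℝ} {p : ℝ} (hp : p < 1) (hM : ScalesAs M p) {ε : ℝ}
    (hε : 0 < ε) : ∀ᶠ N : ℕ in atTop, M N + 2 ≤ ε * N := by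
  obtain ⟨c, C, _, hcC⟩ := hM
  have h1 : Tendsto (fun N : ℕ => C * (N : ℝ) ^ (-(1 - p)) + 2 * (N : ℝ) ^ (-(1 : ℝ))) atTop
      (𝓝 (C * 0 + 2 * 0)) :=
    (((tendsto_rpow_neg_atTop (by linarith)).comp tendsto_natCast_atTop_atTop).const_mul C).add
      (((tendsto_rpow_neg_atTop one_pos).comp tendsto_natCast_atTop_atTop).const_mul 2)
  have h2 : C * 0 + 2 * 0 < ε := by simpa using hε
  filter_upwards [hcC, h1.eventually_lt_const h2, eventually_gt_atTop 0] with N h3 h4 hN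
  have hN' : (0 : ℝ) < N := by exact_mod_cast hN
  have h5 : (N : ℝ) ^ (-(1 - p)) * N = (N : ℝ) ^ p := by
    rw [← rpow_add_one hN'.ne']
    congr 1; ring
  have h6 : (N : ℝ) ^ (-(1 : ℝ)) * N = 1 := by
    rw [rpow_neg_one, inv_mul_cancel₀ hN'.ne']
  calc M N + 2 ≤ C * (N : ℝ) ^ p + 2 := by linarith [h3.2]
    _ = (C * (N : ℝ) ^ (-(1 - p)) + 2 * (N : ℝ) ^ (-(1 : ℝ))) * N := by
      rw [add_mul, mul_assoc, mul_assoc, h5, h6, mul_one]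
    _ ≤ ε * N := by gcongr

theorem tendsto_atTop_of_exponent_lt_one {p : ℝ} {M : ℕ → ℝ} (hp : p < 1)
    (hM : ScalesAs M p) {g : ℝ} (hg : 0 < g) :
    Tendsto (fun N : ℕ => (-1 : ℝ) ^ N * approx M N g) atTop atTop := by
  apply tendsto_neg_one_pow_mul_approx_atTop hg
  -- M(N) may stay bounded when p = 0, so θ need not approach 1; its value at M = 0 is a lower bound
  -- valid for all large N.
  have hθ : 0 < frac g 0 := frac_pos hg (by norm_num)
  have h1 := eventually_add_two_le_mul hp hM (ε := min (1 / 2) (frac g 0 / (2 * exp 3)))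
    (by positivity)
  obtain ⟨c, C, hc, hcC⟩ := hM
  filter_upwards [h1, hcC] with N h2 h3
  have hM0 : 0 ≤ M N := le_trans (by positivity) h3.1
  have h4 : min (1 / 2) (frac g 0 / (2 * exp 3)) * N ≤ 1 / 2 * N := by
    gcongr; exact min_le_left _ _
  have h5 : min (1 / 2) (frac g 0 / (2 * exp 3)) * N ≤ frac g 0 / (2 * exp 3) * N := by
    gcongr; exact min_le_right _ _
  refine ⟨by linarith, by linarith, ?_⟩
  calc 2 * exp 3 * (M N + 2) ≤ 2 * exp 3 * (frac g 0 / (2 * exp 3) * N) := by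
        gcongr
        linarith
    _ = frac g 0 * N := by field_simp
    _ ≤ frac g (M N) * N := by
        gcongr
        exact frac_mono hg.le (by norm_num) hM0

/-- The threshold is independent of g because G ≥ 2 eventually, whence θ ≥ 1/2 and divergence only
needs 4e³(M + 2) ≤ N. The bound M ≤ N/(8e³) leaves N/2 to absorb the constant 8e³. -/
theorem not_convergent_of_linear_small {M : ℕ → ℝ} (hM : ScalesAs M 1)
    (hle : ∀ᶠ N : ℕ in atTop, M N ≤ 1 / (8 * exp 3) * N) {g : ℝ} (hg : 0 < g) :
    ¬ ∃ L : ℝ, Tendsto (fun N : ℕ => approx M N g) atTop (𝓝 L) := by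
  have key : Tendsto (fun N : ℕ => (-1 : ℝ) ^ N * approx M N g) atTop atTop := by
    apply tendsto_neg_one_pow_mul_approx_atTop hg
    obtain ⟨c, C, hc, hcC⟩ := hM
    filter_upwards [hle, hcC, tendsto_natCast_atTop_atTop.eventually_ge_atTop (16 * exp 3),
      tendsto_natCast_atTop_atTop.eventually_ge_atTop (1 / (g * c))] with N h1 h2 h3 h4
    rw [rpow_one] at h2
    have hM0 : 0 ≤ M N := le_trans (by positivity) h2.1
    have he : (1 : ℝ) ≤ exp 3 := by linarith [add_one_le_exp (3 : ℝ)]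
    have h5 : 4 * exp 3 * (M N + 2) ≤ N := by
      calc 4 * exp 3 * (M N + 2) ≤ 4 * exp 3 * (1 / (8 * exp 3) * N + 2) := by gcongr
        _ = N / 2 + 8 * exp 3 := by field_simp; norm_num
        _ ≤ N := by linarith
    have h6 : 1 ≤ √(g * (M N + 2)) := by
      rw [Real.one_le_sqrt]
      rw [div_le_iff₀ (by positivity)] at h4
      nlinarith [h2.1]
    have h7 := half_le_frac (le_trans (by linarith) (le_G hg.le (by linarith : 0 ≤ M N + 2)))
    refine ⟨by linarith, ?_, ?_⟩
    · nlinarith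
    · have : (0 : ℝ) ≤ N := by positivity
      nlinarith
  rintro ⟨L, hL⟩
  refine not_tendsto_nhds_of_tendsto_atTop (tendsto_abs_atTop_atTop.comp key) |L| ?_
  refine hL.abs.congr fun N => ?_
  simp [abs_mul]

/-! ### Exponential convergence for `M(N) = α N` -/

theorem continuousAt_tangentBase {c a : ℝ} (ha : 0 < a) :
    ContinuousAt (tangentBase c) a := by
  unfold tangentBase
  have := ha.ne'
  fun_prop (disch := assumption)

theorem continuousAt_tangentGap {c a : ℝ} (hc : 0 < c) (ha : 0 < a) :
    ContinuousAt (tangentGap c) a := by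
  unfold tangentGap
  have : a + c ≠ 0 := by positivity
  fun_prop (disch := assumption)

/-- The shift by 2 in m costs at most 1 + 2/(α(N+1)) per factor, hence e^{2/α} in total. -/
theorem linear_head_pow_le {α : ℝ} (hα : 0 < α) (N : ℕ) :
    ((α * N + 2) / (α * N + 2 + (N + 1))) ^ (N + 1) ≤ exp (2 / α) * headBase α ^ (N + 1) := by
  have h1 : (α * N + 2) / (α * N + 2 + (N + 1)) ≤ exp (2 / α / (N + 1)) * headBase α := by
    have h2 := add_one_le_exp (2 / α / ((N : ℝ) + 1))
    have h3 : (α * N + 2) / (α * N + 2 + (N + 1)) ≤ (2 / α / ((N : ℝ) + 1) + 1) * headBase α := by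
      unfold headBase
      have : (2 / α / ((N : ℝ) + 1) + 1) * (α / (α + 1)) =
          (2 + α * (N + 1)) / ((N + 1) * (α + 1)) := by
        field_simp
      rw [this, div_le_div_iff₀ (by positivity) (by positivity)]
      have : (0 : ℝ) ≤ N := by positivity
      have : (0 : ℝ) ≤ α * N := by positivity
      have : (0 : ℝ) ≤ α * α * N := by positivity
      nlinarith
    exact h3.trans (mul_le_mul_of_nonneg_right h2 (headBase_pos hα).le)
  calc _ ≤ (exp (2 / α / (N + 1)) * headBase α) ^ (N + 1) := by gcongr
    _ = _ := by
      rw [mul_pow, ← exp_nat_mul]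
      congr 2
      push_cast
      field_simp

theorem exists_linear_error_bound {α : ℝ} (hα : 0.9755 ≤ α) :
    ∃ C : ℝ, 0 ≤ C ∧ ∀ (N : ℕ) (g : ℝ), 0 < g →
      |approx (fun n : ℕ => α * (n : ℝ)) N g - Z g| ≤
        frac g (α * N) ^ (N + 1) * (C * max (tailBase α) (headBase α) ^ N) := by
  have hα0 : 0 < α := by linarith
  obtain ⟨c, hc, hgap, hbase⟩ := exists_tangentBase_lt_max hα
  set Q := max (tailBase α) (headBase α) with hQ
  have hQ0 : 0 < Q := max_base_pos hα0
  -- The strict inequalities survive lowering α to a nearby β, and then β(N + 1) ≤ αN + 2 for large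
  -- N.
  obtain ⟨β, hβ, hβ0, hβα⟩ : ∃ β, (tangentBase c β < Q ∧ 0 < tangentGap c β) ∧ 0 < β ∧ β < α := by
    have h1 := (continuousAt_tangentBase (c := c) hα0).eventually_lt_const hbase
    have h2 := (continuousAt_tangentGap hc hα0).eventually_const_lt hgap
    have h3 : ∀ᶠ β in 𝓝[<] α, (tangentBase c β < Q ∧ 0 < tangentGap c β) ∧ 0 < β ∧ β < α := by
      filter_upwards [nhdsWithin_le_nhds h1, nhdsWithin_le_nhds h2,
        nhdsWithin_le_nhds (eventually_gt_nhds hα0), self_mem_nhdsWithin] with β a1 a2 a3 a4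
      exact ⟨⟨a1, a2⟩, a3, a4⟩
    exact h3.exists
  -- For the finitely many small N only uniformity in g matters. The parameters c = 3 and min α 2
  -- are admissible for every N, with gap at least 1/3.
  have hstep : ∀ N : ℕ, ∃ K : ℝ, 0 ≤ K ∧ ∀ g : ℝ, 0 < g →
      |approx (fun n : ℕ => α * (n : ℝ)) N g - Z g| ≤ frac g (α * N) ^ (N + 1) * (K * Q ^ N) := by
    intro N
    have ham : min α 2 * (N + 1) ≤ α * N + 2 := by
      have h1 : min α 2 * N ≤ α * N := by gcongr; exact min_le_left _ _
      have h2 := min_le_right α 2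
      linarith
    have hmin : 0 < min α 2 := by positivity
    have hgap3 : 0 < tangentGap 3 (min α 2) := by
      unfold tangentGap
      have : 1 / (min α 2 + 3) ≤ 1 / 3 := by gcongr; linarith
      linarith
    refine ⟨(2 * (1 + (α * N + 2) / (N + 1)) ^ 2 *
        ((α * N + 2) / (α * N + 2 + (N + 1))) ^ (N + 1) + √(2 * π / tangentGap 3 (min α 2)) *
        tangentBase 3 (min α 2) ^ (N + 1)) / Q ^ N, ?_, fun g hg => ?_⟩
    · have := tangentBase_pos (by norm_num : (0 : ℝ) < 3) hmin
      positivity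
    · rw [div_mul_cancel₀ _ (by positivity)]
      exact abs_approx_sub_Z_le (M := fun n : ℕ => α * (n : ℝ)) hg (by norm_num) hmin hgap3 ham
  choose K hK0 hK using hstep
  obtain ⟨N₀, hN₀⟩ := exists_nat_ge (β / (α - β))
  set C₁ := 2 * (1 + (α + 2)) ^ 2 * exp (2 / α) * Q + √(2 * π / tangentGap c β) * Q with hC₁
  have hbig : ∀ N : ℕ, N₀ ≤ N → ∀ g : ℝ, 0 < g →
      |approx (fun n : ℕ => α * (n : ℝ)) N g - Z g| ≤
        frac g (α * N) ^ (N + 1) * (C₁ * Q ^ N) := by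
    intro N hN g hg
    have hNβ : β / (α - β) ≤ N := hN₀.trans (by exact_mod_cast hN)
    have ham : β * (N + 1) ≤ α * N + 2 := by
      rw [div_le_iff₀ (by linarith)] at hNβ
      linarith
    refine (abs_approx_sub_Z_le (M := fun n : ℕ => α * (n : ℝ)) hg hc hβ0 hβ.2 ham).trans ?_
    have hm : 0 ≤ α * N + 2 := by positivity
    refine mul_le_mul_of_nonneg_left ?_ (pow_nonneg (frac_nonneg hg.le hm) _)
    have h1 : (α * N + 2) / ((N : ℝ) + 1) ≤ α + 2 := by
      rw [div_le_iff₀ (by positivity)]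
      have : (0 : ℝ) ≤ N := by positivity
      nlinarith
    have h2 : headBase α ^ (N + 1) ≤ Q ^ (N + 1) := by
      have := headBase_pos hα0
      gcongr
      exact le_max_right _ _
    have h3 : tangentBase c β ^ (N + 1) ≤ Q ^ (N + 1) := by
      have := tangentBase_pos hc hβ0
      have := hβ.1
      gcongr
    calc _ ≤ 2 * (1 + (α + 2)) ^ 2 * (exp (2 / α) * Q ^ (N + 1)) +
          √(2 * π / tangentGap c β) * Q ^ (N + 1) := by
          gcongr
          exact (linear_head_pow_le hα0 N).trans (by gcongr)
      _ = _ := by rw [hC₁, pow_succ]; ring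
  have hC₁0 : 0 ≤ C₁ := by positivity
  have hsum0 : 0 ≤ ∑ N ∈ Finset.range N₀, K N := Finset.sum_nonneg fun N _ => hK0 N
  refine ⟨C₁ + ∑ N ∈ Finset.range N₀, K N, by positivity, fun N g hg => ?_⟩
  have hm : 0 ≤ α * N + 2 := by positivity
  have hθ := frac_nonneg hg.le hm
  rcases le_or_gt N₀ N with hN | hN
  · refine (hbig N hN g hg).trans ?_
    gcongr
    linarith
  · refine (hK N g hg).trans ?_
    have : K N ≤ ∑ N ∈ Finset.range N₀, K N :=
      Finset.single_le_sum (fun N _ => hK0 N) (Finset.mem_range.2 hN)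
    gcongr
    linarith

theorem exists_uniform_linear_bound {α : ℝ} (hα : 0.9755 ≤ α) :
    ∃ C : ℝ, ∀ (N : ℕ) (g : ℝ), 0 < g →
      |approx (fun n : ℕ => α * (n : ℝ)) N g - Z g| ≤ C * (10 : ℝ) ^ (-rateA α * (N : ℝ)) := by
  have hα0 : 0 < α := by linarith
  obtain ⟨C, hC, h⟩ := exists_linear_error_bound hα
  refine ⟨C, fun N g hg => (h N g hg).trans ?_⟩
  have hm : 0 ≤ α * N + 2 := by positivity
  rw [rpow_neg_rateA_mul hα0]
  have := max_base_pos hα0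
  exact mul_le_of_le_one_left (by positivity)
    (pow_le_one₀ (frac_nonneg hg.le hm) (frac_le_one hg.le hm))

theorem isBigO_linear_error {α : ℝ} (hα : 0.9755 ≤ α) {g : ℝ} (hg : 0 < g) :
    Asymptotics.IsBigO atTop
      (fun N : ℕ => approx (fun n : ℕ => α * (n : ℝ)) N g - Z g)
      (fun N : ℕ => (10 : ℝ) ^ (-rateA α * (N : ℝ) - rateB α g * √(N : ℝ))) := by
  have hα0 : 0 < α := by linarith
  obtain ⟨C, hC, h⟩ := exists_linear_error_bound hα
  refine Asymptotics.IsBigO.of_bound C ?_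
  filter_upwards [eventually_gt_atTop 0,
    tendsto_natCast_atTop_atTop.eventually_ge_atTop (2 / α),
    tendsto_natCast_atTop_atTop.eventually_ge_atTop (1 / (g * α))] with N hN h1 h2
  have hN' : (0 : ℝ) < N := by exact_mod_cast hN
  have hm : 0 ≤ α * N + 2 := by positivity
  have hQ := max_base_pos hα0
  rw [Real.norm_eq_abs, Real.norm_eq_abs, abs_of_pos (rpow_pos_of_pos (by norm_num) _)]
  refine (h N g hg).trans ?_
  rw [sub_eq_add_neg, rpow_add (by norm_num), rpow_neg_rateA_mul hα0]
  have h3 : (10 : ℝ) ^ (-(rateB α g * √N)) = exp (-(√N / (4 * √(g * α)))) := by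
    rw [rpow_def_of_pos (by norm_num)]
    congr 1
    unfold rateB
    have : 0 < log 10 := log_pos (by norm_num)
    field_simp
  -- With X = √(gα)√N ≥ 1 and αN ≥ 2, G ≤ 1 + 2·(3/2)X ≤ 4X; this 4 is the one in `rateB`.
  have h4 : G g (α * N) ≤ 4 * √(g * α) * √N := by
    have h5 := G_le hg.le hm
    rw [div_le_iff₀ (by positivity)] at h1 h2
    have h6 : 1 ≤ √(g * α) * √N := by
      rw [← Real.sqrt_mul (by positivity), Real.one_le_sqrt]
      linarith
    have h7 : √(g * (α * N + 2)) ≤ 3 / 2 * (√(g * α) * √N) := by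
      apply Real.sqrt_le_iff.2
      refine ⟨by positivity, ?_⟩
      rw [mul_pow, mul_pow, Real.sq_sqrt (by positivity), Real.sq_sqrt hN'.le]
      have h8 : g * (α * N + 2) ≤ g * (2 * (N * α)) := by
        gcongr
        linarith
      have : 0 < g * α * N := by positivity
      nlinarith
    linarith
  have hG : 0 < G g (α * N) := by linarith [one_le_G hg.le hm]
  have h8 : frac g (α * N) ^ (N + 1) ≤ exp (-(√N / (4 * √(g * α)))) := by
    refine (frac_pow_le hg.le hm (N + 1)).trans (exp_le_exp.2 (neg_le_neg ?_))
    rw [div_le_div_iff₀ (by positivity) hG]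
    have h9 : √N * √N = N := Real.mul_self_sqrt hN'.le
    calc √N * G g (α * N) ≤ √N * (4 * √(g * α) * √N) := by gcongr
      _ = N * (4 * √(g * α)) := by linear_combination (4 * √(g * α)) * h9
      _ ≤ _ := by
        push_cast
        gcongr
        linarith
  rw [h3]
  calc _ ≤ exp (-(√N / (4 * √(g * α)))) * (C * max (tailBase α) (headBase α) ^ N) := by gcongr
    _ = _ := by ring

/-! ### Superlinear `M(N)` -/

theorem eventually_mul_le_of_one_lt {M : ℕ → ℝ} {p : ℝ} (hp : 1 < p) (hM : ScalesAs M p) (a : ℝ) :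
    ∀ᶠ N : ℕ in atTop, a * N ≤ M N := by
  obtain ⟨c, C, hc, hcC⟩ := hM
  have h1 : Tendsto (fun N : ℕ => c * (N : ℝ) ^ (p - 1)) atTop atTop :=
    ((tendsto_rpow_atTop (by linarith)).comp tendsto_natCast_atTop_atTop).const_mul_atTop hc
  filter_upwards [hcC, h1.eventually_ge_atTop a, eventually_gt_atTop 0] with N h2 h3 hN
  have hN' : (0 : ℝ) < N := by exact_mod_cast hN
  refine le_trans ?_ h2.1
  have h5 : (N : ℝ) ^ (p - 1) * N = (N : ℝ) ^ p := by
    rw [← rpow_add_one hN'.ne']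
    congr 1; ring
  rw [← h5, ← mul_assoc]
  gcongr

theorem tendsto_zero_of_two_lt_exponent {p : ℝ} {M : ℕ → ℝ} (hp : 2 < p) (hM : ScalesAs M p)
    {g : ℝ} (hg : 0 < g) : Tendsto (fun N : ℕ => approx M N g) atTop (𝓝 0) := by
  have hlin := eventually_mul_le_of_one_lt (by linarith) hM 0.9755
  obtain ⟨c, C, hc, hcC⟩ := hM
  set q := tangentBase 1.63 0.9755 with hq
  have hq0 : 0 < q := tangentBase_pos (by norm_num) (by norm_num)
  set D := √(2 * π / tangentGap 1.63 0.9755) with hD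
  set k := 2 * √(g * c) with hk
  have hk0 : 0 < k := by positivity
  have hlim : Tendsto (fun N : ℕ => 2 * √(8 / k * (N : ℝ) ^ (-(p / 2 - 1))) +
      √(8 * π / k * (N : ℝ) ^ (-(p / 2))) + D * q ^ (N + 1)) atTop (𝓝 0) := by
    have h1 : Tendsto (fun N : ℕ => (N : ℝ) ^ (-(p / 2 - 1))) atTop (𝓝 0) :=
      (tendsto_rpow_neg_atTop (by linarith)).comp tendsto_natCast_atTop_atTop
    have h2 : Tendsto (fun N : ℕ => (N : ℝ) ^ (-(p / 2))) atTop (𝓝 0) :=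
      (tendsto_rpow_neg_atTop (by linarith)).comp tendsto_natCast_atTop_atTop
    have h3 : Tendsto (fun N : ℕ => q ^ (N + 1)) atTop (𝓝 0) :=
      (tendsto_pow_atTop_nhds_zero_of_lt_one hq0.le tangentBase_critical_lt_one).comp
        (tendsto_add_atTop_nat 1)
    have := (((h1.const_mul (8 / k)).sqrt.const_mul 2).add (h2.const_mul (8 * π / k)).sqrt).add
      (h3.const_mul D)
    simpa using this
  refine squeeze_zero_norm' ?_ hlim
  filter_upwards [hlin, hcC, eventually_gt_atTop 0] with N h1 h2 hN
  have hN' : (0 : ℝ) < N := by exact_mod_cast hN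
  have hm : 0 ≤ M N + 2 := by linarith [mul_pos (by norm_num : (0 : ℝ) < 0.9755) hN']
  rw [Real.norm_eq_abs]
  refine (abs_approx_le hg (by norm_num) (by norm_num) tangentGap_critical_pos
    (by linarith)).trans ?_
  have hG : k * (N : ℝ) ^ (p / 2) ≤ G g (M N) := by
    refine le_trans ?_ (le_G hg.le hm)
    have h3 : (N : ℝ) ^ (p / 2) = √((N : ℝ) ^ p) := by
      rw [Real.sqrt_eq_rpow, ← rpow_mul hN'.le]
      congr 1; ring
    rw [hk, h3, mul_assoc, ← Real.sqrt_mul (by positivity), mul_assoc g]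
    gcongr
    linarith [h2.1]
  have hpow : (0 : ℝ) < (N : ℝ) ^ (p / 2) := by positivity
  have e1 : 8 * N / G g (M N) ≤ 8 / k * (N : ℝ) ^ (-(p / 2 - 1)) := by
    have : (N : ℝ) ^ (-(p / 2 - 1)) = N / (N : ℝ) ^ (p / 2) := by
      rw [neg_sub, rpow_sub hN', rpow_one]
    rw [this, div_mul_div_comm]
    gcongr
  have e2 : 8 * π / G g (M N) ≤ 8 * π / k * (N : ℝ) ^ (-(p / 2)) := by
    rw [rpow_neg hN'.le, ← div_eq_mul_inv, div_div]
    gcongr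
  gcongr

theorem exists_stretched_exponential_bound {p : ℝ} {M : ℕ → ℝ} (hp1 : 1 ≤ p) (hp2 : p < 2)
    (hM : ScalesAs M p) (hlin : ∀ᶠ N : ℕ in atTop, 0.9755 * (N : ℝ) ≤ M N) :
    ∃ (A : ℝ) (B : ℝ → ℝ), 0 < A ∧ (∀ g : ℝ, 0 < g → 0 < B g) ∧
      ∀ᶠ N : ℕ in atTop, ∀ g : ℝ, 0 < g →
        |approx M N g - Z g| ≤
          exp (-A * (N : ℝ) ^ (2 - p) - B g * (N : ℝ) ^ (1 - p / 2)) := by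
  obtain ⟨c, C, hc, hcC⟩ := hM
  set q := tangentBase 1.63 0.9755 with hq
  have hq0 : 0 < q := tangentBase_pos (by norm_num) (by norm_num)
  have hlogq : 0 < -log q := neg_pos.2 (log_neg hq0 tangentBase_critical_lt_one)
  set D := √(2 * π / tangentGap 1.63 0.9755) with hD
  have hC : 0 < C := by
    obtain ⟨N, hN, hN1⟩ := (hcC.and (eventually_gt_atTop 0)).exists
    have hN' : (0 : ℝ) < N := by exact_mod_cast hN1
    have : 0 < (N : ℝ) ^ p := by positivity
    exact hc.trans_le (le_of_mul_le_mul_right (hN.1.trans hN.2) this)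
  set C₁ := C + 2 with hC₁
  -- Head and tail both decay at least like exp(-2Ay) with y = N^{2-p}; half of that rate is spent
  -- on the polynomial prefactor.
  set A := min (1 / (C₁ + 1)) (-log q) / 2 with hA
  have hA0 : 0 < A := by positivity
  refine ⟨A, fun g => 1 / (1 + 2 * √(g * C₁)), hA0, fun g hg => by positivity, ?_⟩
  -- The exponent 2/(2 - p) turns y into N², the order of the prefactor.
  have hgrow : ∀ᶠ N : ℕ in atTop, 2 * (1 + C₁) ^ 2 + D ≤
      exp (A * (N : ℝ) ^ (2 - p)) / ((N : ℝ) ^ (2 - p)) ^ (2 / (2 - p)) :=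
    ((tendsto_exp_mul_div_rpow_atTop (2 / (2 - p)) A hA0).comp
      ((tendsto_rpow_atTop (by linarith)).comp
        tendsto_natCast_atTop_atTop)).eventually_ge_atTop _
  filter_upwards [hcC, hlin, hgrow, eventually_ge_atTop 1] with N h1 h2 h3 hN g hg
  have hN1 : (1 : ℝ) ≤ N := by exact_mod_cast hN
  have hN' : (0 : ℝ) < N := by linarith
  have hNp : (N : ℝ) ≤ (N : ℝ) ^ p := by
    calc (N : ℝ) = (N : ℝ) ^ (1 : ℝ) := (rpow_one _).symm
      _ ≤ _ := rpow_le_rpow_of_exponent_le hN1 hp1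
  have hm : 0 < M N + 2 := by linarith
  have hmC : M N + 2 ≤ C₁ * (N : ℝ) ^ p := by
    rw [hC₁, add_mul]
    linarith [h1.2]
  have hy2 : ((N : ℝ) ^ (2 - p)) ^ (2 / (2 - p)) = (N : ℝ) ^ 2 := by
    rw [← rpow_mul hN'.le, mul_div_cancel₀ _ (by linarith : 2 - p ≠ 0)]
    norm_num
  rw [hy2, le_div_iff₀ (by positivity)] at h3
  set y := (N : ℝ) ^ (2 - p) with hy
  have hy0 : 0 < y := by positivity
  have hyp : y * (N : ℝ) ^ p = (N : ℝ) ^ 2 := by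
    rw [hy, ← rpow_add hN']
    norm_num
  have hyN : y ≤ N := by
    calc y ≤ (N : ℝ) ^ (1 : ℝ) := rpow_le_rpow_of_exponent_le hN1 (by linarith)
      _ = N := rpow_one _
  set m := M N + 2 with hmdef
  have hAκ : 2 * A ≤ 1 / (C₁ + 1) := by
    rw [hA]; linarith [min_le_left (1 / (C₁ + 1)) (-log q)]
  have hAq : 2 * A ≤ -log q := by
    rw [hA]; linarith [min_le_right (1 / (C₁ + 1)) (-log q)]
  -- With n = N + 1 the bound is exp(-n²/(m+n)), and y(m+n) ≤ (C₁+1)n² because yN^p = N² and, as p ≥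
  -- 1, y ≤ N.
  have hhead : (m / (m + (N + 1))) ^ (N + 1) ≤ exp (-(2 * A * y)) := by
    have b1 : m / (m + (N + 1)) ≤ exp (-((N + 1) / (m + (N + 1)))) := by
      have b2 : m / (m + ((N : ℝ) + 1)) = -((N + 1) / (m + (N + 1))) + 1 := by
        field_simp; ring
      rw [b2]
      exact add_one_le_exp _
    calc _ ≤ exp (-((N + 1) / (m + (N + 1)))) ^ (N + 1) := by gcongr
      _ = exp (-((N + 1) * (N + 1) / (m + (N + 1)))) := by
        rw [← exp_nat_mul]; congr 1; push_cast; ring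
      _ ≤ _ := by
        apply exp_le_exp.2 (neg_le_neg _)
        have b3 : 2 * A * y ≤ 1 / (C₁ + 1) * y := by gcongr
        refine b3.trans ?_
        rw [one_div, inv_mul_eq_div, div_le_div_iff₀ (by positivity) (by positivity)]
        have b4 : y * m ≤ C₁ * (N : ℝ) ^ 2 := by
          rw [← hyp]; nlinarith
        have b5 : y * (N + 1) ≤ (N : ℝ) * (N + 1) := by gcongr
        nlinarith
  have htail : q ^ (N + 1) ≤ exp (-(2 * A * y)) := by
    rw [← exp_log hq0, ← exp_nat_mul]
    apply exp_le_exp.2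
    push_cast
    have b1 : 2 * A * y ≤ -log q * (N + 1) := by
      apply mul_le_mul hAq (by linarith) hy0.le hlogq.le
    linarith
  have hpre : 2 * (1 + m / (N + 1)) ^ 2 ≤ 2 * (1 + C₁) ^ 2 * (N : ℝ) ^ 2 := by
    have b1 : m / ((N : ℝ) + 1) ≤ C₁ * N := by
      rw [div_le_iff₀ (by positivity)]
      have b2 : (N : ℝ) ^ p ≤ (N : ℝ) ^ 2 := by
        calc (N : ℝ) ^ p ≤ (N : ℝ) ^ (2 : ℝ) := rpow_le_rpow_of_exponent_le hN1 hp2.le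
          _ = _ := by norm_num
      have b3 : C₁ * (N : ℝ) ^ p ≤ C₁ * (N : ℝ) ^ 2 := by gcongr
      have : 0 < C₁ * N := by positivity
      nlinarith
    have b4 : 1 + m / ((N : ℝ) + 1) ≤ (1 + C₁) * N := by linarith
    have b5 := pow_le_pow_left₀ (by positivity) b4 2
    rw [mul_pow] at b5
    linarith
  have hbracket : 2 * (1 + m / (N + 1)) ^ 2 * (m / (m + (N + 1))) ^ (N + 1) + D * q ^ (N + 1) ≤
      exp (-(A * y)) := by
    calc _ ≤ 2 * (1 + C₁) ^ 2 * (N : ℝ) ^ 2 * exp (-(2 * A * y)) +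
          D * exp (-(2 * A * y)) := by gcongr
      _ ≤ (2 * (1 + C₁) ^ 2 + D) * (N : ℝ) ^ 2 * exp (-(2 * A * y)) := by
          have b1 : D ≤ D * (N : ℝ) ^ 2 := le_mul_of_one_le_right (by positivity)
            (one_le_pow₀ hN1)
          have := mul_le_mul_of_nonneg_right b1 (exp_pos (-(2 * A * y))).le
          linarith
      _ ≤ exp (A * y) * exp (-(2 * A * y)) := by gcongr
      _ = exp (-(A * y)) := by rw [← exp_add]; congr 1; ring
  have hθ : frac g (M N) ^ (N + 1) ≤
      exp (-(1 / (1 + 2 * √(g * C₁)) * (N : ℝ) ^ (1 - p / 2))) := by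
    refine (frac_pow_le hg.le hm.le (N + 1)).trans (exp_le_exp.2 (neg_le_neg ?_))
    have hG0 : 0 < G g (M N) := by linarith [one_le_G hg.le hm.le]
    have hroot : √((N : ℝ) ^ p) = (N : ℝ) ^ (p / 2) := by
      rw [Real.sqrt_eq_rpow, ← rpow_mul hN'.le]
      congr 1; ring
    have hG : G g (M N) ≤ (1 + 2 * √(g * C₁)) * (N : ℝ) ^ (p / 2) := by
      refine (G_le hg.le hm.le).trans ?_
      have b1 : √(g * (M N + 2)) ≤ √(g * C₁) * (N : ℝ) ^ (p / 2) := by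
        rw [← hroot, ← Real.sqrt_mul (by positivity), mul_assoc]
        gcongr
      have b2 : 1 ≤ (N : ℝ) ^ (p / 2) := one_le_rpow hN1 (by linarith)
      linarith
    rw [one_div, inv_mul_eq_div, div_le_div_iff₀ (by positivity) hG0]
    have hsplit : (N : ℝ) ^ (1 - p / 2) * (N : ℝ) ^ (p / 2) = N := by
      rw [← rpow_add hN']; norm_num
    calc (N : ℝ) ^ (1 - p / 2) * G g (M N) ≤
          (N : ℝ) ^ (1 - p / 2) * ((1 + 2 * √(g * C₁)) * (N : ℝ) ^ (p / 2)) := by gcongr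
      _ = N * (1 + 2 * √(g * C₁)) := by linear_combination (1 + 2 * √(g * C₁)) * hsplit
      _ ≤ _ := by
        push_cast
        gcongr
        linarith
  refine (abs_approx_sub_Z_le hg (by norm_num) (by norm_num) tangentGap_critical_pos
    (by linarith)).trans ?_
  calc _ ≤ exp (-(1 / (1 + 2 * √(g * C₁)) * (N : ℝ) ^ (1 - p / 2))) * exp (-(A * y)) := by
        gcongr
    _ = _ := by rw [← exp_add]; congr 1; ring

theorem tendstoUniformlyOn_of_stretched_exponential_bound {p A : ℝ} {B : ℝ → ℝ} {M : ℕ → ℝ}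
    (hp : p < 2) (hA : 0 < A) (hB : ∀ g : ℝ, 0 < g → 0 < B g)
    (h : ∀ᶠ N : ℕ in atTop, ∀ g : ℝ, 0 < g → |approx M N g - Z g| ≤
      exp (-A * (N : ℝ) ^ (2 - p) - B g * (N : ℝ) ^ (1 - p / 2))) :
    TendstoUniformlyOn (fun (N : ℕ) (g : ℝ) => approx M N g) Z atTop (Set.Ioi 0) := by
  rw [Metric.tendstoUniformlyOn_iff]
  intro ε hε
  have hlim : Tendsto (fun N : ℕ => exp (-(A * (N : ℝ) ^ (2 - p)))) atTop (𝓝 0) :=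
    tendsto_exp_neg_atTop_nhds_zero.comp
      (((tendsto_rpow_atTop (by linarith)).comp tendsto_natCast_atTop_atTop).const_mul_atTop hA)
  filter_upwards [h, hlim.eventually_lt_const hε] with N h1 h2 g hg
  rw [dist_comm, Real.dist_eq]
  refine ((h1 g hg).trans (exp_le_exp.2 ?_)).trans_lt h2
  have := hB g hg
  have : 0 ≤ B g * (N : ℝ) ^ (1 - p / 2) := by positivity
  linarith

end SCE

/-! ### Assembly of the three regimes -/

theorem proposition1 :
    -- Case 1: divergence for `0 ≤ p < 1`
    (∀ (p : ℝ) (M : ℕ → ℝ), 0 ≤ p → p < 1 → SCE.ScalesAs M p →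
      ∀ g : ℝ, 0 < g →
        Tendsto (fun N : ℕ => (-1 : ℝ) ^ N * SCE.approx M N g) atTop atTop) ∧
    -- Case 2: the critical value `αc` and the optimal value `αs` of the bound
    (∃ αc αs : ℝ,
      |αc - 0.976| ≤ 0.0005 ∧ (∀ α : ℝ, 0 < α → (SCE.tailBase α = 1 ↔ α = αc)) ∧
      |αs - 1.317| ≤ 0.0005 ∧
      (∀ α : ℝ, 0 < α → (SCE.tailBase α = SCE.headBase α ↔ α = αs)) ∧
      -- Case 2a: uniform convergence with its rate, for `1 < p < 2`, and for `p = 1` if `M(N)/N`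
      -- is sufficiently large
      (∀ (p : ℝ) (M : ℕ → ℝ), 1 ≤ p → p < 2 → SCE.ScalesAs M p →
        (p = 1 → ∃ a : ℝ, αc < a ∧ ∀ᶠ N : ℕ in atTop, a * (N : ℝ) ≤ M N) →
        TendstoUniformlyOn (fun (N : ℕ) (g : ℝ) => SCE.approx M N g) SCE.Z atTop (Set.Ioi 0) ∧
        ∃ (A : ℝ) (B : ℝ → ℝ), 0 < A ∧ (∀ g : ℝ, 0 < g → 0 < B g) ∧
          ∀ᶠ N : ℕ in atTop, ∀ g : ℝ, 0 < g →
            |SCE.approx M N g - SCE.Z g| ≤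
              Real.exp (-A * (N : ℝ) ^ (2 - p) - B g * (N : ℝ) ^ (1 - p / 2))) ∧
      -- Case 2b: `M(N) = α N` with `α > αc` converges uniformly and exponentially fast
      (∀ α : ℝ, αc < α →
        0 < SCE.rateA α ∧
        (∃ C : ℝ, ∀ (N : ℕ) (g : ℝ), 0 < g →
          |SCE.approx (fun n : ℕ => α * (n : ℝ)) N g - SCE.Z g| ≤
            C * (10 : ℝ) ^ (-SCE.rateA α * (N : ℝ))) ∧
        ∀ g : ℝ, 0 < g →
          Asymptotics.IsBigO atTop
            (fun N : ℕ => SCE.approx (fun n : ℕ => α * (n : ℝ)) N g - SCE.Z g)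
            (fun N : ℕ =>
              (10 : ℝ) ^ (-SCE.rateA α * (N : ℝ) - SCE.rateB α g * √(N : ℝ)))) ∧
      -- the rate `A` by cases, and its optimum at `αs`
      (∀ α : ℝ, 0 < α → α ≤ αs → SCE.rateA α = -Real.logb 10 (SCE.tailBase α)) ∧
      (∀ α : ℝ, αs ≤ α → SCE.rateA α = -Real.logb 10 (SCE.headBase α)) ∧
      (∀ α : ℝ, 0 < α → α ≠ αs → SCE.rateA α < SCE.rateA αs) ∧
      0.245 ≤ SCE.rateA αs ∧ SCE.rateA αs ≤ 0.2455 ∧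
      -- for `p = 1`, convergence holds only if `M(N)/N` is sufficiently large
      (∃ α₀ : ℝ, 0 < α₀ ∧ ∀ M : ℕ → ℝ, SCE.ScalesAs M 1 →
        (∀ᶠ N : ℕ in atTop, M N ≤ α₀ * (N : ℝ)) →
        ∀ g : ℝ, 0 < g →
          ¬ ∃ L : ℝ, Tendsto (fun N : ℕ => SCE.approx M N g) atTop (𝓝 L))) ∧
    -- Case 3: convergence to `0` for `p > 2`
    (∀ (p : ℝ) (M : ℕ → ℝ), 2 < p → SCE.ScalesAs M p →
      ∀ g : ℝ, 0 < g →
        Tendsto (fun N : ℕ => SCE.approx M N g) atTop (𝓝 0)) := by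
  refine ⟨fun p M _ hp hM g hg => SCE.tendsto_atTop_of_exponent_lt_one hp hM hg, ?_,
    fun p M hp hM g hg => SCE.tendsto_zero_of_two_lt_exponent hp hM hg⟩
  obtain ⟨αc, hc1, hc2, hc⟩ := SCE.exists_tailBase_eq_one
  obtain ⟨αs, hs1, hs2, hs⟩ := SCE.exists_tailBase_eq_headBase
  have hc0 : 0 < αc := by linarith
  have hs0 : 0 < αs := by linarith
  have hopt := SCE.rateA_optimal_bounds hs1 hs2 hs
  refine ⟨αc, αs, ?_, fun α hα => ⟨fun h => ?_, fun h => h ▸ hc⟩, ?_,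
    fun α hα => ⟨fun h => ?_, fun h => h ▸ hs⟩, fun p M hp1 hp2 hM ha => ?_, fun α hα => ?_,
    fun α hα h => SCE.rateA_eq_of_le hα h hs, fun α h => SCE.rateA_eq_of_ge hs0 h hs,
    fun α hα hne => SCE.rateA_lt_of_ne hα hs0 hs hne, hopt.1, hopt.2,
    1 / (8 * Real.exp 3), by positivity,
    fun M hM hle g hg => SCE.not_convergent_of_linear_small hM hle hg⟩
  · rw [abs_le]
    constructor <;> linarith
  · exact SCE.tailBase_strictAntiOn.injOn hα hc0 (h.trans hc.symm)
  · rw [abs_le]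
    constructor <;> linarith
  · by_contra hne
    rcases lt_or_gt_of_ne hne with h' | h'
    · have h1 := SCE.tailBase_strictAntiOn hα hs0 h'
      have h2 := SCE.headBase_strictMonoOn hα hs0 h'
      linarith
    · have h1 := SCE.tailBase_strictAntiOn hs0 hα h'
      have h2 := SCE.headBase_strictMonoOn hs0 hα h'
      linarith
  · have hlin : ∀ᶠ N : ℕ in atTop, 0.9755 * (N : ℝ) ≤ M N := by
      rcases hp1.eq_or_lt with h | h
      · obtain ⟨a, ha1, ha2⟩ := ha h.symm
        filter_upwards [ha2] with N hN
        refine le_trans ?_ hN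
        gcongr
        linarith
      · exact SCE.eventually_mul_le_of_one_lt h hM _
    obtain ⟨A, B, hA, hB, h⟩ := SCE.exists_stretched_exponential_bound hp1 hp2 hM hlin
    exact ⟨SCE.tendstoUniformlyOn_of_stretched_exponential_bound hp2 hA hB h, A, B, hA, hB, h⟩
  · have hα1 : 0.9755 ≤ α := by linarith
    have hα0 : 0 < α := by linarith
    refine ⟨SCE.rateA_pos_of_max_lt_one hα0 (max_lt ?_ (SCE.headBase_lt_one hα0)),
      SCE.exists_uniform_linear_bound hα1, fun g hg => SCE.isBigO_linear_error hα1 hg⟩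
    rw [← hc]
    exact SCE.tailBase_strictAntiOn hc0 hα0 hα
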